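/- Let $R$ and $S$ be associative rings with unit, and let ${}_R\omega_S$ be a semidualizing $(R,S)$-bimodule, that is: ${}_R\omega$ and $\omega_S$ admit projective resolutions consisting of finitely generated projective modules (over $R$ and over $S^{op}$, respectively); the homothety maps $R\to\mathrm{Hom}_{S^{op}}(\omega,\omega)$ and $S\to\mathrm{Hom}_R(\omega,\omega)$ are bijective; and $\mathrm{Ext}_R^{i}(\omega,\omega)=0=\mathrm{Ext}_{S^{op}}^{i}(\omega,\omega)$ for all $i\ge 1$. Call $\omega$ right semi-tilting if it is semidualizing and the projective dimension $\mathrm{pd}_{S^{op}}\,\omega$ of the right $S$-module $\omega$ is finite. Let ${}_R\omega^{\perp}$ be the class of left $R$-modules $M$ with $\mathrm{Ext}_R^i(\omega,M)=0$ for all $i\ge 1$. Let the Bass class $\mathcal{B}_\omega(R)$ be the class of left $R$-modules $M$ such that $M\in{}_R\omega^\perp$, $\mathrm{Tor}_i^S(\omega,\mathrm{Hom}_R(\omega,M))=0$ for all $i\ge 1$, and the evaluation map $\omega\otimes_S\mathrm{Hom}_R(\omega,M)\to M$, $x\otimes f\mapsto f(x)$, is an isomorphism. The Bass injective dimension $\mathcal{B}_\omega(R)\text{-}\mathrm{id}_R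 M$ of a left $R$-module $M$ is the infimum of the integers $n\ge 0$ for which there is an exact sequence $0\to M\to X^0\to X^1\to\cdots\to X^n\to 0$ of left $R$-modules with all $X^i\in\mathcal{B}_\omega(R)$ (and $\infty$ if there is none). (1) If ${}_R\omega_S$ is right semi-tilting, then $\mathcal{B}_\omega(R)={}_R\omega^{\perp}$. (2) If $S$ is left coherent, that is, every finitely generated left ideal of $S$ is finitely presented, then for every integer $n\ge 0$: ${}_R\omega_S$ is right semi-tilting with $\mathrm{pd}_{S^{op}}\,\omega\le n$ if and only if $\mathcal{B}_\omega(R)\text{-}\mathrm{id}_R R\le n$. -/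

import Mathlib

open CategoryTheory
open scoped TensorProduct

universe u

noncomputable section

namespace SemidualizingBimodule

/-! Right `S`-modules are modules over `Sᵐᵒᵖ`; an `(R, S)`-bimodule `ω` carries commuting module
structures over `R` and over `Sᵐᵒᵖ`. All modules are taken in one fixed universe. -/

/-! ### The tensor product over a noncommutative ring -/

section Tensor

variable (R S ω : Type u) [Ring R] [Ring S] [AddCommGroup ω] [Module R ω] [Module Sᵐᵒᵖ ω]

/-- The relations `(x s) ⊗ y = x ⊗ (s y)`. The generating set is stable under the action of `R`
(which commutes with that of `S`), so its `R`-span is the additive subgroup it generates. -/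
def balancedRel (N : Type u) [AddCommGroup N] [Module S N] : Submodule R (ω ⊗[ℤ] N) :=
  Submodule.span R {t | ∃ (x : ω) (s : S) (y : N),
    t = (MulOpposite.op s • x) ⊗ₜ[ℤ] y - x ⊗ₜ[ℤ] (s • y)}

/-- The left `R`-module `ω ⊗_S N` for an `(R, S)`-bimodule `ω` and a left `S`-module `N`. -/
abbrev BimodTensor (N : Type u) [AddCommGroup N] [Module S N] : Type u :=
  (ω ⊗[ℤ] N) ⧸ balancedRel R S ω N

/-- The map `ω ⊗_S f`. -/
def bimodTensorMap {N N' : Type u} [AddCommGroup N] [Module S N] [AddCommGroup N'] [Module S N']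
    (f : N →ₗ[S] N') : BimodTensor R S ω N →ₗ[R] BimodTensor R S ω N' :=
  Submodule.mapQ _ _
    (TensorProduct.AlgebraTensorModule.lTensor R ω f.toAddMonoidHom.toIntLinearMap) <| by
      rw [balancedRel, Submodule.span_le]
      rintro _ ⟨x, s, y, rfl⟩
      refine Submodule.subset_span ⟨x, s, f y, ?_⟩
      simp

theorem bimodTensor_ext {N : Type u} [AddCommGroup N] [Module S N] {P : Type u} [AddCommGroup P]
    [Module R P] {f g : BimodTensor R S ω N →ₗ[R] P}
    (h : ∀ (x : ω) (y : N), f (Submodule.Quotient.mk (x ⊗ₜ[ℤ] y)) =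
      g (Submodule.Quotient.mk (x ⊗ₜ[ℤ] y))) : f = g := by
  refine LinearMap.ext fun t => ?_
  obtain ⟨t, rfl⟩ := Submodule.Quotient.mk_surjective _ t
  induction t using TensorProduct.induction_on with
  | zero => simp
  | tmul x y => exact h x y
  | add a b ha hb => rw [Submodule.Quotient.mk_add, map_add, map_add, ha, hb]

/-- The functor `ω ⊗_S -` from left `S`-modules to left `R`-modules. -/
def tensorFunctor : ModuleCat.{u} S ⥤ ModuleCat.{u} R where
  obj N := ModuleCat.of R (BimodTensor R S ω N)
  map f := ModuleCat.ofHom (bimodTensorMap R S ω f.hom)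
  map_id _ := ModuleCat.hom_ext <| bimodTensor_ext R S ω fun _ _ => rfl
  map_comp _ _ := ModuleCat.hom_ext <| bimodTensor_ext R S ω fun _ _ => rfl

instance tensorFunctor_additive : (tensorFunctor R S ω).Additive where
  map_add {_ _ f g} := ModuleCat.hom_ext <| bimodTensor_ext R S ω fun x y =>
    congrArg Submodule.Quotient.mk (TensorProduct.tmul_add x (f.hom y) (g.hom y))

/-- `Tor_i^S(ω, N)`, the value at `N` of the `i`-th left derived functor of `ω ⊗_S -`. -/
def tor (i : ℕ) (N : ModuleCat.{u} S) : ModuleCat.{u} R :=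
  ((tensorFunctor R S ω).leftDerived i).obj N

end Tensor

/-! ### The left `S`-module `Hom_R(ω, M)` and the evaluation map -/

section Hom

variable (R S ω : Type u) [Ring R] [Ring S] [AddCommGroup ω] [Module R ω] [Module Sᵐᵒᵖ ω]
  [SMulCommClass R Sᵐᵒᵖ ω] (M : Type u) [AddCommGroup M] [Module R M]

/-- The homothety map `S → Hom_R(ω, ω)`, `s ↦ (x ↦ x s)`. -/
def homothetyRight (s : S) : ω →ₗ[R] ω where
  toFun x := MulOpposite.op s • x
  map_add' := smul_add _
  map_smul' r x := (smul_comm r (MulOpposite.op s) x).symm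

/-- The underlying group of `Hom_R(ω, M)`, to be regarded as a left `S`-module. -/
@[nolint unusedArguments]
def HomFrom (R S ω : Type u) [Ring R] [Ring S] [AddCommGroup ω] [Module R ω] (M : Type u)
    [AddCommGroup M] [Module R M] : Type u := ω →ₗ[R] M

instance : AddCommGroup (HomFrom R S ω M) := inferInstanceAs (AddCommGroup (ω →ₗ[R] M))

/-- The left `S`-action `(s f)(x) = f(x s)`. -/
instance : Module S (HomFrom R S ω M) where
  smul s f := LinearMap.comp (show ω →ₗ[R] M from f) (homothetyRight R S ω s)
  one_smul f := LinearMap.ext fun x => by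
    change (show ω →ₗ[R] M from f) (MulOpposite.op (1 : S) • x) = (show ω →ₗ[R] M from f) x
    simp
  mul_smul s t f := LinearMap.ext fun x => by
    change (show ω →ₗ[R] M from f) (MulOpposite.op (s * t) • x) =
      (show ω →ₗ[R] M from f) (MulOpposite.op t • MulOpposite.op s • x)
    rw [MulOpposite.op_mul, mul_smul]
  smul_zero s := LinearMap.ext fun x => rfl
  smul_add s f g := LinearMap.ext fun x => rfl
  add_smul s t f := LinearMap.ext fun x => by
    change (show ω →ₗ[R] M from f) (MulOpposite.op (s + t) • x) =
      (show ω →ₗ[R] M from f) (MulOpposite.op s • x) +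
        (show ω →ₗ[R] M from f) (MulOpposite.op t • x)
    rw [MulOpposite.op_add, add_smul, map_add]
  zero_smul f := LinearMap.ext fun x => by
    change (show ω →ₗ[R] M from f) (MulOpposite.op (0 : S) • x) = 0
    rw [MulOpposite.op_zero, zero_smul, map_zero]

/-- The evaluation map `θ_M : ω ⊗_S Hom_R(ω, M) → M`, `x ⊗ f ↦ f x`. -/
def theta : BimodTensor R S ω (HomFrom R S ω M) →ₗ[R] M :=
  Submodule.liftQ _
    (TensorProduct.AlgebraTensorModule.lift
      ({ toFun := fun x =>
           { toFun := fun f => (show ω →ₗ[R] M from f) x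
             map_add' := fun _ _ => rfl
             map_smul' := fun n f => LinearMap.smul_apply n (show ω →ₗ[R] M from f) x }
         map_add' := fun x y => LinearMap.ext fun f => map_add (show ω →ₗ[R] M from f) x y
         map_smul' := fun r x => LinearMap.ext fun f => map_smul (show ω →ₗ[R] M from f) r x } :
        ω →ₗ[R] HomFrom R S ω M →ₗ[ℤ] M)) <| by
    rw [balancedRel, Submodule.span_le]
    rintro _ ⟨x, s, f, rfl⟩
    rw [SetLike.mem_coe, LinearMap.mem_ker, map_sub, sub_eq_zero]
    rfl

end Hom

/-! ### Semidualizing bimodules -/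

/-- `M` has a projective resolution by finitely generated projective modules. -/
def HasDegreewiseFiniteProjectiveResolution (A M : Type u) [Ring A] [AddCommGroup M]
    [Module A M] : Prop :=
  ∃ P : ProjectiveResolution (ModuleCat.of A M), ∀ i : ℕ, Module.Finite A (P.complex.X i)

section Semidualizing

variable (R S ω : Type u) [Ring R] [Ring S] [AddCommGroup ω] [Module R ω] [Module Sᵐᵒᵖ ω]
  [SMulCommClass R Sᵐᵒᵖ ω]

/-- The homothety map `R → Hom_{S^op}(ω, ω)`, `r ↦ (x ↦ r x)`. -/
def homothetyLeft (r : R) : ω →ₗ[Sᵐᵒᵖ] ω :=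
  DistribSMul.toLinearMap Sᵐᵒᵖ ω r

/-- The `(R, S)`-bimodule `ω` is semidualizing. -/
structure IsSemidualizing : Prop where
  finite_left : HasDegreewiseFiniteProjectiveResolution R ω
  finite_right : HasDegreewiseFiniteProjectiveResolution Sᵐᵒᵖ ω
  homothety_left : Function.Bijective (homothetyLeft R S ω)
  homothety_right : Function.Bijective (homothetyRight R S ω)
  ext_left : ∀ i : ℕ, 1 ≤ i →
    Subsingleton (Abelian.Ext (ModuleCat.of R ω) (ModuleCat.of R ω) i)
  ext_right : ∀ i : ℕ, 1 ≤ i →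
    Subsingleton (Abelian.Ext (ModuleCat.of Sᵐᵒᵖ ω) (ModuleCat.of Sᵐᵒᵖ ω) i)

/-- The projective dimension of the right `S`-module `ω`. -/
def pdRight (S ω : Type u) [Ring S] [AddCommGroup ω] [Module Sᵐᵒᵖ ω] : WithBot ℕ∞ :=
  projectiveDimension (ModuleCat.of Sᵐᵒᵖ ω)

/-- A right semi-tilting bimodule: semidualizing, of finite projective dimension as a right
module. -/
structure IsRightSemiTilting : Prop where
  semidualizing : IsSemidualizing R S ω
  pd_lt_top : pdRight S ω < ⊤

/-- The class `ω^⊥` of left `R`-modules `M` with `Ext_R^i(ω, M) = 0` for all `i ≥ 1`. -/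
def extPerp (R ω : Type u) [Ring R] [AddCommGroup ω] [Module R ω] :
    ObjectProperty (ModuleCat.{u} R) :=
  fun M => ∀ i : ℕ, 1 ≤ i → Subsingleton (Abelian.Ext (ModuleCat.of R ω) M i)

/-- The Bass class of `ω`. -/
def bassClass : ObjectProperty (ModuleCat.{u} R) := fun M =>
  extPerp R ω M ∧
  (∀ i : ℕ, 1 ≤ i → Subsingleton (tor R S ω i (ModuleCat.of S (HomFrom R S ω M)))) ∧
  Function.Bijective (theta R S ω M)

end Semidualizing

/-! ### Injective dimension relative to a class of modules -/

section RelativeDimension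

variable {R : Type u} [Ring R]

/-- There is an exact sequence `0 → M → X⁰ → X¹ → ⋯ → Xⁿ → 0` with all `Xⁱ` in the class `X`. -/
def HasCoresolution (X : ObjectProperty (ModuleCat.{u} R)) (M : ModuleCat.{u} R) (n : ℕ) : Prop :=
  ∃ (C : ℕ → ModuleCat.{u} R) (ε : M →ₗ[R] C 0) (d : ∀ i, C i →ₗ[R] C (i + 1)),
    (∀ i ≤ n, X (C i)) ∧ (∀ i > n, Subsingleton (C i)) ∧
    Function.Injective ε ∧ Function.Exact ε (d 0) ∧ ∀ i, Function.Exact (d i) (d (i + 1))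

/-- The injective dimension of `M` relative to the class `X`: the infimum of the lengths of its
finite coresolutions by modules of `X`, which is `⊤` if there are none. -/
def relInjDim (X : ObjectProperty (ModuleCat.{u} R)) (M : ModuleCat.{u} R) : ℕ∞ :=
  ⨅ (n : ℕ) (_ : HasCoresolution X M n), (n : ℕ∞)

end RelativeDimension

/-- A left coherent ring: every finitely generated left ideal is finitely presented. -/
def IsLeftCoherent (S : Type u) [Ring S] : Prop :=
  ∀ I : Ideal S, I.FG → Module.FinitePresentation S I

end SemidualizingBimodule

end

open CategoryTheory
open scoped TensorProduct

noncomputable section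

namespace SemidualizingBimodule

/-! ### Short exact sequences of modules and dimension shifting for Ext -/

section ShortExactSequences

/-! The Bass class is the largest class of modules in `ω^⊥` in which every member is a quotient of
some `ω^(I)` with kernel again in the class (`HasCovers`). For a sum `ω^(I)` the evaluation `θ` is
bijective and `Hom_R(ω, ω^(I))` is free over `S`. So, for `0 → L → ω^(I) → M → 0` with `Hom_R(ω, -)`
exact on it, the Bass conditions on `M` translate into conditions on `L`: injectivity of `θ_M` is
surjectivity of `θ_L`, vanishing of `Tor_1` is injectivity of `θ_L`, and higher Tor shifts down
(`HasCovers.le_bassClass`, `hasCovers_bassClass`).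

For (1) it suffices that `ω` generates each `M` in `ω^⊥`. Let `0 → K → P → ω → 0` be exact over
`S^op` with `P` finitely generated projective. Applying `Hom(-, ω)` gives `0 → R → Hom(P, ω) →
Hom(K, ω) → 0`. Finite projective dimension makes `Ext_R(Hom(K, ω), M)` vanish, so every map `R → M`
extends to `Hom(P, ω)`, a summand of a finite power of `ω`. Continuing the dualized resolution
yields the coresolution of `R` of length `n` in (2).

For the converse in (2), a Bass coresolution of `R` is traded for a surjection `H → R`, where `H`
has a coresolution of length at most `n` by sums of `ω` (`HasCoresolution.exists_approximation`).
The surjection splits, so `ω` is a summand of `Hom_R(H, ω)`. By coherence the modules `Hom_R(ω^(I),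
ω) ≅ S^I` are flat (Chase), so the flat dimension of `ω` is at most `n`. It is measured as the
injective dimension of the character module, and the finite resolution of `ω` turns it into
projective dimension. -/

theorem exists_comp_eq_of_ker_le {A : Type*} [Ring A] {X Y Z : Type*} [AddCommGroup X] [Module A X]
    [AddCommGroup Y] [Module A Y] [AddCommGroup Z] [Module A Z] {f : X →ₗ[A] Y}
    (hf : Function.Surjective f) (u : X →ₗ[A] Z) (h : LinearMap.ker f ≤ LinearMap.ker u) :
    ∃ v : Y →ₗ[A] Z, v ∘ₗ f = u := by
  let e := f.quotKerEquivOfSurjective hf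
  refine ⟨(LinearMap.ker f).liftQ u h ∘ₗ e.symm.toLinearMap, LinearMap.ext fun x => ?_⟩
  change (LinearMap.ker f).liftQ u h (e.symm (f x)) = u x
  have : e.symm (f x) = Submodule.Quotient.mk x := e.symm_apply_eq.2 rfl
  rw [this]
  rfl

variable {A : Type u} [Ring A]

/-- The sequence `0 → X₁ → X₂ → X₃ → 0` is exact. -/
structure IsSES {X₁ X₂ X₃ : Type u} [AddCommGroup X₁] [Module A X₁] [AddCommGroup X₂] [Module A X₂]
    [AddCommGroup X₃] [Module A X₃] (f : X₁ →ₗ[A] X₂) (g : X₂ →ₗ[A] X₃) : Prop where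
  inj : Function.Injective f
  exact : Function.Exact f g
  surj : Function.Surjective g

theorem isSES_ker {X₂ X₃ : Type u} [AddCommGroup X₂] [Module A X₂]
    [AddCommGroup X₃] [Module A X₃] {g : X₂ →ₗ[A] X₃} (hg : Function.Surjective g) :
    IsSES (LinearMap.ker g).subtype g :=
  ⟨Subtype.val_injective, LinearMap.exact_subtype_ker_map g, hg⟩

variable {X₁ X₂ X₃ : Type u} [AddCommGroup X₁] [Module A X₁] [AddCommGroup X₂] [Module A X₂]
    [AddCommGroup X₃] [Module A X₃] {f : X₁ →ₗ[A] X₂} {g : X₂ →ₗ[A] X₃}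

/-- The short complex in the module category given by a short exact sequence of modules. -/
abbrev IsSES.toShortComplex (h : IsSES f g) : ShortComplex (ModuleCat.{u} A) :=
  ShortComplex.mk (ModuleCat.ofHom f) (ModuleCat.ofHom g)
    (ModuleCat.hom_ext h.exact.linearMap_comp_eq_zero)

theorem IsSES.shortExact (h : IsSES f g) : h.toShortComplex.ShortExact :=
  ModuleCat.shortComplex_shortExact _ h.exact h.inj h.surj

/-- `Ext_A^i(X, Y) = 0` for all `i ≥ 1`. -/
def ExtVanish (A X Y : Type u) [Ring A] [AddCommGroup X] [Module A X] [AddCommGroup Y]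
    [Module A Y] : Prop :=
  ∀ i : ℕ, 1 ≤ i → Subsingleton (Abelian.Ext (ModuleCat.of A X) (ModuleCat.of A Y) i)

variable {Y Y' : Type u} [AddCommGroup Y] [Module A Y] [AddCommGroup Y'] [Module A Y']

open Abelian in
theorem IsSES.ext_middle (h : IsSES f g) {X : ModuleCat.{u} A} {i : ℕ}
    (h₁ : Subsingleton (Ext X (ModuleCat.of A X₁) i))
    (h₃ : Subsingleton (Ext X (ModuleCat.of A X₃) i)) :
    Subsingleton (Ext X (ModuleCat.of A X₂) i) := by
  refine subsingleton_of_forall_eq 0 fun x => ?_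
  obtain ⟨y, rfl⟩ := Ext.covariant_sequence_exact₂ X h.shortExact x (h₃.elim _ _)
  rw [h₁.elim y 0, Ext.zero_comp]

open Abelian in
theorem IsSES.ext_left (h : IsSES f g) {X : ModuleCat.{u} A} {i : ℕ}
    (h₂ : Subsingleton (Ext X (ModuleCat.of A X₂) (i + 1)))
    (h₃ : Subsingleton (Ext X (ModuleCat.of A X₃) i)) :
    Subsingleton (Ext X (ModuleCat.of A X₁) (i + 1)) := by
  refine subsingleton_of_forall_eq 0 fun x => ?_
  obtain ⟨y, rfl⟩ := Ext.covariant_sequence_exact₁ X h.shortExact x (h₂.elim _ _) rfl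
  rw [h₃.elim y 0, Ext.zero_comp]

open Abelian in
theorem IsSES.ext_one_left (h : IsSES f g) {X : Type u} [AddCommGroup X] [Module A X]
    (h₂ : Subsingleton (Ext (ModuleCat.of A X) (ModuleCat.of A X₂) 1))
    (h₃ : ∀ u : X →ₗ[A] X₃, ∃ v : X →ₗ[A] X₂, g ∘ₗ v = u) :
    Subsingleton (Ext (ModuleCat.of A X) (ModuleCat.of A X₁) 1) := by
  refine subsingleton_of_forall_eq 0 fun x => ?_
  obtain ⟨y, rfl⟩ := Ext.covariant_sequence_exact₁ _ h.shortExact x (h₂.elim _ _) (zero_add 1)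
  obtain ⟨u, rfl⟩ := Ext.mk₀_bijective _ _ |>.2 y
  obtain ⟨v, hv⟩ := h₃ u.hom
  have : u = ModuleCat.ofHom v ≫ h.toShortComplex.g := by
    ext x; exact (LinearMap.congr_fun hv x).symm
  rw [this, ← Ext.mk₀_comp_mk₀, Ext.comp_assoc _ _ _ (zero_add 0) (zero_add 1) (by simp),
    h.shortExact.comp_extClass, Ext.comp_zero]

open Abelian in
theorem IsSES.lift_of_ext (h : IsSES f g) {X : Type u} [AddCommGroup X] [Module A X]
    (h₁ : Subsingleton (Ext (ModuleCat.of A X) (ModuleCat.of A X₁) 1)) (u : X →ₗ[A] X₃) :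
    ∃ v : X →ₗ[A] X₂, g ∘ₗ v = u := by
  obtain ⟨y, hy⟩ := Ext.covariant_sequence_exact₃ _ h.shortExact
    (Ext.mk₀ (ModuleCat.ofHom u)) (zero_add 1) (h₁.elim _ _)
  obtain ⟨v, rfl⟩ := Ext.mk₀_bijective _ _ |>.2 y
  rw [Ext.mk₀_comp_mk₀] at hy
  exact ⟨v.hom, congrArg ModuleCat.Hom.hom ((Ext.mk₀_bijective _ _).1 hy)⟩

open Abelian in
theorem IsSES.extend_of_ext (h : IsSES f g)
    (h₁ : Subsingleton (Ext (ModuleCat.of A X₃) (ModuleCat.of A Y) 1)) (u : X₁ →ₗ[A] Y) :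
    ∃ v : X₂ →ₗ[A] Y, v ∘ₗ f = u := by
  obtain ⟨y, hy⟩ := Ext.contravariant_sequence_exact₁ h.shortExact _
    (Ext.mk₀ (ModuleCat.ofHom u)) (add_zero 1) (h₁.elim _ _)
  obtain ⟨v, rfl⟩ := Ext.mk₀_bijective _ _ |>.2 y
  rw [Ext.mk₀_comp_mk₀] at hy
  exact ⟨v.hom, congrArg ModuleCat.Hom.hom ((Ext.mk₀_bijective _ _).1 hy)⟩

open Abelian in
theorem IsSES.ext_contra_left (h : IsSES f g) {Y : ModuleCat.{u} A} {i : ℕ}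
    (h₂ : Subsingleton (Ext (ModuleCat.of A X₂) Y i))
    (h₃ : Subsingleton (Ext (ModuleCat.of A X₃) Y (i + 1))) :
    Subsingleton (Ext (ModuleCat.of A X₁) Y i) := by
  refine subsingleton_of_forall_eq 0 fun x => ?_
  obtain ⟨y, rfl⟩ := Ext.contravariant_sequence_exact₁ h.shortExact _ x (add_comm 1 i) (h₃.elim _ _)
  rw [h₂.elim y 0, Ext.comp_zero]

open Abelian in
theorem IsSES.ext_contra_right (h : IsSES f g) {Y : ModuleCat.{u} A} {i : ℕ}
    (h₂ : Subsingleton (Ext (ModuleCat.of A X₂) Y (i + 1)))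
    (h₁ : Subsingleton (Ext (ModuleCat.of A X₁) Y i)) :
    Subsingleton (Ext (ModuleCat.of A X₃) Y (i + 1)) := by
  refine subsingleton_of_forall_eq 0 fun x => ?_
  obtain ⟨y, rfl⟩ := Ext.contravariant_sequence_exact₃ h.shortExact _ x (h₂.elim _ _) (add_comm 1 i)
  rw [h₁.elim y 0, Ext.comp_zero]

open Abelian in
theorem IsSES.ext_one_contra_right (h : IsSES f g)
    (h₂ : Subsingleton (Ext (ModuleCat.of A X₂) (ModuleCat.of A Y) 1))
    (h₁ : ∀ u : X₁ →ₗ[A] Y, ∃ v : X₂ →ₗ[A] Y, v ∘ₗ f = u) :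
    Subsingleton (Ext (ModuleCat.of A X₃) (ModuleCat.of A Y) 1) := by
  refine subsingleton_of_forall_eq 0 fun x => ?_
  obtain ⟨y, rfl⟩ := Ext.contravariant_sequence_exact₃ h.shortExact _ x (h₂.elim _ _) (add_zero 1)
  obtain ⟨u, rfl⟩ := Ext.mk₀_bijective _ _ |>.2 y
  obtain ⟨v, hv⟩ := h₁ u.hom
  have : u = h.toShortComplex.f ≫ ModuleCat.ofHom v := by
    ext x; exact (LinearMap.congr_fun hv x).symm
  rw [this, ← Ext.mk₀_comp_mk₀, ← Ext.comp_assoc _ _ _ (add_zero 1) (zero_add 0) (by simp),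
    h.shortExact.extClass_comp, Ext.zero_comp]

theorem extVanish_of_projective {X : Type u} [AddCommGroup X] [Module A X] [Module.Projective A X] :
    ExtVanish A X Y := by
  intro i hi
  obtain ⟨i, rfl⟩ := Nat.exists_eq_add_of_le' hi
  have : Projective (ModuleCat.of A X) := (IsProjective.iff_projective X).1 inferInstance
  exact Abelian.Ext.subsingleton_of_projective _ _ _

open Abelian in
theorem ExtVanish.of_retract {X X' : Type u} [AddCommGroup X] [Module A X] [AddCommGroup X']
    [Module A X'] (h : ExtVanish A X Y) (i : X' →ₗ[A] X) (r : X →ₗ[A] X')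
    (hri : r ∘ₗ i = LinearMap.id) : ExtVanish A X' Y := by
  intro n hn
  refine subsingleton_of_forall_eq 0 fun x => ?_
  have : ModuleCat.ofHom i ≫ ModuleCat.ofHom r = 𝟙 _ := ModuleCat.hom_ext hri
  rw [← x.mk₀_id_comp, ← this, ← Ext.mk₀_comp_mk₀, Ext.comp_assoc_of_second_deg_zero,
    (h n hn).elim ((Ext.mk₀ _).comp x (zero_add n)) 0, Ext.comp_zero]

open Abelian in
theorem ExtVanish.of_retract_right {X : Type u} [AddCommGroup X] [Module A X]
    (h : ExtVanish A X Y) (i : Y' →ₗ[A] Y) (r : Y →ₗ[A] Y')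
    (hri : r ∘ₗ i = LinearMap.id) : ExtVanish A X Y' := by
  intro n hn
  refine subsingleton_of_forall_eq 0 fun x => ?_
  have : ModuleCat.ofHom i ≫ ModuleCat.ofHom r = 𝟙 _ := ModuleCat.hom_ext hri
  rw [← x.comp_mk₀_id, ← this, ← Ext.mk₀_comp_mk₀, ← Ext.comp_assoc _ _ _ (add_zero n)
    (zero_add 0) (by simp), (h n hn).elim (x.comp (Ext.mk₀ _) (add_zero n)) 0, Ext.zero_comp]

section

variable {X : Type u} [AddCommGroup X] [Module A X]

theorem IsSES.extVanish_middle (h : IsSES f g) (h₁ : ExtVanish A X X₁) (h₃ : ExtVanish A X X₃) :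
    ExtVanish A X X₂ :=
  fun i hi => h.ext_middle (h₁ i hi) (h₃ i hi)

theorem IsSES.extVanish_left (h : IsSES f g) (h₂ : ExtVanish A X X₂) (h₃ : ExtVanish A X X₃)
    (hl : ∀ u : X →ₗ[A] X₃, ∃ v : X →ₗ[A] X₂, g ∘ₗ v = u) : ExtVanish A X X₁
  | 0, hi => absurd hi (by omega)
  | 1, hi => h.ext_one_left (h₂ 1 hi) hl
  | i + 2, hi => h.ext_left (h₂ _ hi) (h₃ (i + 1) (by omega))

theorem IsSES.extVanish_contra_left (h : IsSES f g) (h₂ : ExtVanish A X₂ Y)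
    (h₃ : ExtVanish A X₃ Y) : ExtVanish A X₁ Y :=
  fun i hi => h.ext_contra_left (h₂ i hi) (h₃ _ (by omega))

end

end ShortExactSequences

/-! ### Resolutions by finitely generated projectives, and Ext with direct sums -/

section FinitePresentations

variable {A : Type u} [Ring A]

/-- `M` has a resolution by finitely generated projective modules, expressed through a class of
modules that contains `M` and is closed under taking suitable first syzygies. -/
def IsFPInfty (A M : Type u) [Ring A] [AddCommGroup M] [Module A M] : Prop :=
  ∃ Z : ObjectProperty (ModuleCat.{u} A), Z (ModuleCat.of A M) ∧ ∀ X : ModuleCat.{u} A, Z X →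
    ∃ (P : ModuleCat.{u} A) (f : P →ₗ[A] X), Module.Finite A P ∧ Module.Projective A P ∧
      Function.Surjective f ∧ Z (ModuleCat.of A (LinearMap.ker f))

/-- The same class serves for the syzygy, so the property passes to it and supports dimension
shifting by induction over all such modules. -/
theorem IsFPInfty.exists_cover {M : Type u} [AddCommGroup M] [Module A M] (h : IsFPInfty A M) :
    ∃ (P : ModuleCat.{u} A) (f : P →ₗ[A] M), Module.Finite A P ∧ Module.Projective A P ∧
      Function.Surjective f ∧ IsFPInfty A (LinearMap.ker f) := by
  obtain ⟨Z, hM, hZ⟩ := h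
  obtain ⟨P, f, h₁, h₂, h₃, h₄⟩ := hZ _ hM
  exact ⟨P, f, h₁, h₂, h₃, Z, h₄, hZ⟩

theorem IsFPInfty.finite {M : Type u} [AddCommGroup M] [Module A M] (h : IsFPInfty A M) :
    Module.Finite A M := by
  obtain ⟨P, f, _, _, hf, _⟩ := h.exists_cover
  exact Module.Finite.of_surjective f hf

theorem HasDegreewiseFiniteProjectiveResolution.isFPInfty {M : Type u} [AddCommGroup M]
    [Module A M] (h : HasDegreewiseFiniteProjectiveResolution A M) : IsFPInfty A M := by
  obtain ⟨P, hP⟩ := h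
  have hproj (i : ℕ) : Module.Projective A (P.complex.X i) :=
    (IsProjective.iff_projective _).2 (P.projective i)
  refine ⟨fun X => Nonempty (X ≃ₗ[A] M) ∨
    ∃ i, Nonempty (X ≃ₗ[A] LinearMap.range (P.complex.d (i + 1) i).hom), Or.inl ⟨.refl _ _⟩, ?_⟩
  rintro X (⟨⟨e⟩⟩ | ⟨i, ⟨e⟩⟩)
  · have hπ : Function.Surjective (P.π.f 0).hom :=
      (ModuleCat.epi_iff_surjective (P.π.f 0)).1 inferInstance
    have hk : LinearMap.range (P.complex.d 1 0).hom = LinearMap.ker (P.π.f 0).hom :=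
      P.exact₀.moduleCat_range_eq_ker
    refine ⟨P.complex.X 0, e.symm.toLinearMap ∘ₗ (P.π.f 0).hom, hP 0, hproj 0,
      e.symm.surjective.comp hπ, Or.inr ⟨0, ⟨LinearEquiv.ofEq _ _ ?_⟩⟩⟩
    rw [hk]
    exact LinearEquiv.ker_comp _ _
  · refine ⟨P.complex.X (i + 1), e.symm.toLinearMap ∘ₗ (P.complex.d (i + 1) i).hom.rangeRestrict,
      hP _, hproj _, e.symm.surjective.comp (LinearMap.surjective_rangeRestrict _),
      Or.inr ⟨i + 1, ⟨LinearEquiv.ofEq _ _ ?_⟩⟩⟩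
    rw [LinearEquiv.ker_comp, LinearMap.ker_rangeRestrict]
    exact ((P.exact_succ i).moduleCat_range_eq_ker).symm

theorem exists_finset_support_subset {X Y I : Type u} [AddCommGroup X] [Module A X]
    [AddCommGroup Y] [Module A Y] [Module.Finite A X] (u : X →ₗ[A] (I →₀ Y)) :
    ∃ T : Finset I, ∀ x, (u x).support ⊆ T := by
  classical
  obtain ⟨s, hs⟩ := Module.Finite.fg_top (R := A) (M := X)
  refine ⟨s.biUnion fun x => (u x).support, fun x => ?_⟩
  have : ⊤ ≤ (Finsupp.supported Y A (s.biUnion fun x => (u x).support : Set I)).comap u := by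
    rw [← hs, Submodule.span_le]
    intro x hx
    simp only [Submodule.comap_coe, Set.mem_preimage, SetLike.mem_coe, Finsupp.mem_supported]
    exact_mod_cast Finset.subset_biUnion_of_mem (fun x => (u x).support) hx
  exact_mod_cast (Finsupp.mem_supported A _).1 (this (Submodule.mem_top (x := x)))

/-- Extending each component separately only gives a map to the product. Since `X₁` is finitely
generated, finitely many components are nonzero and the others are extended by zero. -/
theorem exists_finsupp_extension {X₁ X₂ Y : Type u} [AddCommGroup X₁] [Module A X₁]
    [AddCommGroup X₂] [Module A X₂] [AddCommGroup Y] [Module A Y] [Module.Finite A X₁]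
    (f : X₁ →ₗ[A] X₂) (I : Type u) (h : ∀ u : X₁ →ₗ[A] Y, ∃ v : X₂ →ₗ[A] Y, v ∘ₗ f = u)
    (u : X₁ →ₗ[A] (I →₀ Y)) : ∃ v : X₂ →ₗ[A] (I →₀ Y), v ∘ₗ f = u := by
  obtain ⟨T, hT⟩ := exists_finset_support_subset u
  choose v hv using fun i : I => h (Finsupp.lapply i ∘ₗ u)
  refine ⟨∑ i ∈ T, Finsupp.lsingle i ∘ₗ v i, LinearMap.ext fun x => ?_⟩
  have hv' (i : I) : v i (f x) = u x i := LinearMap.congr_fun (hv i) x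
  simp only [LinearMap.comp_apply, LinearMap.sum_apply, hv', Finsupp.lsingle_apply]
  exact (Finsupp.sum_of_support_subset (u x) (hT x) Finsupp.single (by simp)).symm.trans
    (Finsupp.sum_single _)

theorem IsFPInfty.extVanish_finsupp {K Y : Type u} [AddCommGroup K] [Module A K]
    [AddCommGroup Y] [Module A Y] (hK : IsFPInfty A K) (h : ExtVanish A K Y) (I : Type u) :
    ExtVanish A K (I →₀ Y) := by
  intro i hi
  induction i, hi using Nat.le_induction generalizing K with
  | base =>
    obtain ⟨P, f, _, _, hf, hk⟩ := hK.exists_cover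
    have := hk.finite
    refine (isSES_ker hf).ext_one_contra_right (extVanish_of_projective 1 le_rfl) ?_
    exact exists_finsupp_extension _ I (fun u => (isSES_ker hf).extend_of_ext (h 1 le_rfl) u)
  | succ i hi ih =>
    obtain ⟨P, f, _, _, hf, hk⟩ := hK.exists_cover
    exact (isSES_ker hf).ext_contra_right (extVanish_of_projective _ (by omega))
      (ih hk ((isSES_ker hf).extVanish_contra_left extVanish_of_projective h))

theorem IsSES.finsupp {X₁ X₂ X₃ : Type u} [AddCommGroup X₁] [Module A X₁] [AddCommGroup X₂]
    [Module A X₂] [AddCommGroup X₃] [Module A X₃] {f : X₁ →ₗ[A] X₂} {g : X₂ →ₗ[A] X₃}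
    (h : IsSES f g) (I : Type u) :
    IsSES (Finsupp.mapRange.linearMap (α := I) f) (Finsupp.mapRange.linearMap (α := I) g) where
  inj := Finsupp.mapRange_injective f (map_zero f) h.inj
  surj := Finsupp.mapRange_surjective g (map_zero g) h.surj
  exact := by
    classical
    intro y
    constructor
    · intro hy
      choose! s hs using fun z : X₂ => (h.exact z).1
      have hz : s 0 = 0 := h.inj (by rw [hs 0 (map_zero g), map_zero])
      refine ⟨Finsupp.mapRange s hz y, Finsupp.ext fun i => ?_⟩
      exact hs _ (DFunLike.congr_fun hy i)
    · rintro ⟨x, rfl⟩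
      exact Finsupp.ext fun i => h.exact.apply_apply_eq_zero (x i)

theorem ExtVanish.finsupp_left {X Y : Type u} [AddCommGroup X] [Module A X]
    [AddCommGroup Y] [Module A Y] (h : ExtVanish A X Y) (I : Type u) :
    ExtVanish A (I →₀ X) Y := by
  intro i hi
  induction i, hi using Nat.le_induction generalizing X with
  | base =>
    have hf : Function.Surjective (Finsupp.linearCombination A (id : X → X)) :=
      Finsupp.linearCombination_id_surjective A X
    refine ((isSES_ker hf).finsupp I).ext_one_contra_right (extVanish_of_projective 1 le_rfl) ?_
    intro u
    choose v hv using fun i : I =>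
      (isSES_ker hf).extend_of_ext (h 1 le_rfl) (u ∘ₗ Finsupp.lsingle i)
    refine ⟨Finsupp.lsum ℕ v, Finsupp.lhom_ext fun i x => ?_⟩
    simpa using LinearMap.congr_fun (hv i) x
  | succ i hi ih =>
    have hf : Function.Surjective (Finsupp.linearCombination A (id : X → X)) :=
      Finsupp.linearCombination_id_surjective A X
    exact ((isSES_ker hf).finsupp I).ext_contra_right (extVanish_of_projective _ (by omega))
      (ih ((isSES_ker hf).extVanish_contra_left extVanish_of_projective h))

end FinitePresentations

/-! ### Splicing a projective resolution onto a short exact sequence -/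

section Splicing

variable {A : Type u} [Ring A] {X₁ X₂ X₃ : Type u} [AddCommGroup X₁] [Module A X₁]
  [AddCommGroup X₂] [Module A X₂] [AddCommGroup X₃] [Module A X₃]
  {f : X₁ →ₗ[A] X₂} {g : X₂ →ₗ[A] X₃}

/-- The augmentation `P₀ → N` of a projective resolution. -/
def augmentation {N : ModuleCat.{u} A} (P : ProjectiveResolution N) : P.complex.X 0 ⟶ N := P.π.f 0

theorem augmentation_surjective {N : ModuleCat.{u} A} (P : ProjectiveResolution N) :
    Function.Surjective (augmentation P).hom :=
  (ModuleCat.epi_iff_surjective (P.π.f 0)).1 inferInstance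

theorem d_comp_augmentation {N : ModuleCat.{u} A} (P : ProjectiveResolution N) :
    P.complex.d 1 0 ≫ augmentation P = 0 := P.complex_d_comp_π_f_zero

theorem exact_augmentation {N : ModuleCat.{u} A} (P : ProjectiveResolution N) :
    Function.Exact (P.complex.d 1 0).hom (augmentation P).hom :=
  (ShortComplex.ShortExact.moduleCat_exact_iff_function_exact _).1 P.exact₀

/-- The chain complex obtained by splicing a projective resolution of `X₁` with
`0 → X₁ → X₂ → X₃ → 0`. -/
def spliceComplex (f : X₁ →ₗ[A] X₂) (P : ProjectiveResolution (ModuleCat.of A X₁)) :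
    ChainComplex (ModuleCat.{u} A) ℕ :=
  P.complex.augment (X := ModuleCat.of A X₂) (augmentation P ≫ ModuleCat.ofHom f) (by
    rw [← Category.assoc, d_comp_augmentation, Limits.zero_comp])

theorem spliceComplex_d_comp (h : IsSES f g) (P : ProjectiveResolution (ModuleCat.of A X₁)) :
    (spliceComplex f P).d 1 0 ≫ (ModuleCat.ofHom g : ModuleCat.of A X₂ ⟶ ModuleCat.of A X₃) =
      0 := by
  change (augmentation P ≫ ModuleCat.ofHom f) ≫ ModuleCat.ofHom g = 0
  rw [Category.assoc, h.toShortComplex.zero, Limits.comp_zero]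

theorem exact_spliceComplex_zero (h : IsSES f g) (P : ProjectiveResolution (ModuleCat.of A X₁)) :
    (ShortComplex.mk ((spliceComplex f P).d 1 0) (ModuleCat.ofHom g : ModuleCat.of A X₂ ⟶ _)
      (spliceComplex_d_comp h P)).Exact := by
  refine (ShortComplex.ShortExact.moduleCat_exact_iff_function_exact _).2 fun x => ?_
  refine (h.exact x).trans ⟨?_, ?_⟩
  · rintro ⟨y, rfl⟩
    obtain ⟨z, rfl⟩ := augmentation_surjective P y
    exact ⟨z, rfl⟩
  · rintro ⟨z, rfl⟩
    exact ⟨(augmentation P).hom z, rfl⟩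

theorem exactAt_spliceComplex (h : IsSES f g) (P : ProjectiveResolution (ModuleCat.of A X₁))
    (n : ℕ) : (spliceComplex f P).ExactAt (n + 1) := by
  rcases n with _ | n
  · rw [HomologicalComplex.exactAt_iff' _ 2 1 0 (by simp) (by simp)]
    refine (ShortComplex.ShortExact.moduleCat_exact_iff_function_exact _).2 fun x => ?_
    refine Iff.trans ?_ (exact_augmentation P x)
    exact map_eq_zero_iff f h.inj
  · rw [HomologicalComplex.exactAt_iff' _ (n + 3) (n + 2) (n + 1) (by simp) (by simp)]
    exact P.exact_succ n

/-- Splicing a projective resolution of `X₁` with `0 → X₁ → X₂ → X₃ → 0`, where `X₂` is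
projective. -/
def IsSES.splice (h : IsSES f g) [Module.Projective A X₂]
    (P : ProjectiveResolution (ModuleCat.of A X₁)) : ProjectiveResolution (ModuleCat.of A X₃) where
  complex := spliceComplex f P
  projective
    | 0 => (IsProjective.iff_projective X₂).1 inferInstance
    | i + 1 => P.projective i
  hasHomology := inferInstance
  π := (ChainComplex.toSingle₀Equiv _ _).symm ⟨ModuleCat.ofHom g, spliceComplex_d_comp h P⟩
  quasiIso := ⟨fun n => by
    cases n
    · rw [ChainComplex.quasiIsoAt₀_iff, ShortComplex.quasiIso_iff_of_zeros']
      · exact ⟨exact_spliceComplex_zero h P,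
          (ModuleCat.epi_iff_surjective (ModuleCat.ofHom g)).2 h.surj⟩
      all_goals rfl
    · rw [quasiIsoAt_iff_exactAt']
      · exact exactAt_spliceComplex h P _
      · apply ChainComplex.exactAt_succ_single_obj⟩

end Splicing

/-! ### Right exactness of the tensor product and dimension shifting for Tor -/

section Tor

variable (R S ω : Type u) [Ring R] [Ring S] [AddCommGroup ω] [Module R ω] [Module Sᵐᵒᵖ ω]

theorem tor_subsingleton_iff {N : ModuleCat.{u} S} (P : ProjectiveResolution N) (i : ℕ) :
    Subsingleton (tor R S ω (i + 1) N) ↔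
      Function.Exact (bimodTensorMap R S ω (P.complex.d (i + 2) (i + 1)).hom)
        (bimodTensorMap R S ω (P.complex.d (i + 1) i).hom) := by
  have e := P.isoLeftDerivedObj (tensorFunctor R S ω) (i + 1)
  rw [← ModuleCat.isZero_iff_subsingleton, tor, e.isZero_iff]
  refine (HomologicalComplex.exactAt_iff_isZero_homology _ (i + 1)).symm.trans ?_
  rw [HomologicalComplex.exactAt_iff' _ (i + 2) (i + 1) i (by simp) (by simp)]
  exact ShortComplex.ShortExact.moduleCat_exact_iff_function_exact _

variable {R S ω} in
theorem bimodTensorMap_mk {N N' : Type u} [AddCommGroup N] [Module S N] [AddCommGroup N']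
    [Module S N'] (f : N →ₗ[S] N') (t : ω ⊗[ℤ] N) :
    bimodTensorMap R S ω f (Submodule.Quotient.mk t) =
      Submodule.Quotient.mk (LinearMap.lTensor ω f.toAddMonoidHom.toIntLinearMap t) := rfl

theorem bimodTensorMap_surjective {N N' : Type u} [AddCommGroup N] [Module S N] [AddCommGroup N']
    [Module S N'] {f : N →ₗ[S] N'} (hf : Function.Surjective f) :
    Function.Surjective (bimodTensorMap R S ω f) := by
  intro t
  obtain ⟨t, rfl⟩ := Submodule.Quotient.mk_surjective _ t
  obtain ⟨s, rfl⟩ := LinearMap.lTensor_surjective ω (g := f.toAddMonoidHom.toIntLinearMap) hf t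
  exact ⟨Submodule.Quotient.mk s, rfl⟩

theorem bimodTensorMap_comp {N N' N'' : Type u} [AddCommGroup N] [Module S N] [AddCommGroup N']
    [Module S N'] [AddCommGroup N''] [Module S N''] (g : N' →ₗ[S] N'') (f : N →ₗ[S] N') :
    bimodTensorMap R S ω (g ∘ₗ f) = bimodTensorMap R S ω g ∘ₗ bimodTensorMap R S ω f :=
  bimodTensor_ext R S ω fun _ _ => rfl

/-- Right exactness holds over `ℤ`. It descends to the quotients because the balancing relations of
`N''` lift to those of `N'` along the surjection `g`. -/
theorem bimodTensorMap_exact {N N' N'' : Type u} [AddCommGroup N] [Module S N] [AddCommGroup N']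
    [Module S N'] [AddCommGroup N''] [Module S N''] {f : N →ₗ[S] N'} {g : N' →ₗ[S] N''}
    (hfg : Function.Exact f g) (hg : Function.Surjective g) :
    Function.Exact (bimodTensorMap R S ω f) (bimodTensorMap R S ω g) := by
  let lt := TensorProduct.AlgebraTensorModule.lTensor R ω g.toAddMonoidHom.toIntLinearMap
  have hrel : balancedRel R S ω N'' ≤ (balancedRel R S ω N').map lt := by
    rw [balancedRel, Submodule.span_le]
    rintro _ ⟨x, s, y, rfl⟩
    obtain ⟨y, rfl⟩ := hg y
    exact ⟨_, Submodule.subset_span ⟨x, s, y, rfl⟩, by simp [lt]⟩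
  have hex := lTensor_exact (f := f.toAddMonoidHom.toIntLinearMap)
    (g := g.toAddMonoidHom.toIntLinearMap) ω hfg hg
  intro t
  constructor
  · obtain ⟨t, rfl⟩ := Submodule.Quotient.mk_surjective _ t
    intro ht
    rw [bimodTensorMap_mk, Submodule.Quotient.mk_eq_zero] at ht
    obtain ⟨b, hb, hbt⟩ := hrel ht
    obtain ⟨c, hc⟩ := (hex (t - b)).1 (by rw [map_sub, sub_eq_zero]; exact hbt.symm)
    refine ⟨Submodule.Quotient.mk c, ?_⟩
    rw [bimodTensorMap_mk, hc, Submodule.Quotient.mk_sub, (Submodule.Quotient.mk_eq_zero _).2 hb,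
      sub_zero]
  · rintro ⟨s, rfl⟩
    obtain ⟨s, rfl⟩ := Submodule.Quotient.mk_surjective _ s
    rw [bimodTensorMap_mk, bimodTensorMap_mk, hex.apply_apply_eq_zero, Submodule.Quotient.mk_zero]

variable {N₁ N₂ N₃ : Type u} [AddCommGroup N₁] [Module S N₁]
  [AddCommGroup N₂] [Module S N₂] [AddCommGroup N₃] [Module S N₃]
  {f : N₁ →ₗ[S] N₂} {g : N₂ →ₗ[S] N₃}

theorem IsSES.tor_succ (h : IsSES f g) [Module.Projective S N₂] (i : ℕ) :
    Subsingleton (tor R S ω (i + 2) (ModuleCat.of S N₃)) ↔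
      Subsingleton (tor R S ω (i + 1) (ModuleCat.of S N₁)) := by
  let P := projectiveResolution (ModuleCat.of S N₁)
  rw [tor_subsingleton_iff R S ω P, tor_subsingleton_iff R S ω (h.splice P)]
  -- The spliced resolution has the differentials of `P` shifted by one degree.
  rfl

/-- The last differential of the spliced resolution is `P₀ → N₁ → N₂`. Since `ω ⊗ N₁` is the
cokernel of `ω ⊗ P₁ → ω ⊗ P₀`, exactness at `ω ⊗ P₀` says that nothing further is killed. -/
theorem IsSES.tor_one (h : IsSES f g) [Module.Projective S N₂] :
    Subsingleton (tor R S ω 1 (ModuleCat.of S N₃)) ↔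
      Function.Injective (bimodTensorMap R S ω f) := by
  let P := projectiveResolution (ModuleCat.of S N₁)
  rw [tor_subsingleton_iff R S ω (h.splice P)]
  have hex := bimodTensorMap_exact R S ω (exact_augmentation P) (augmentation_surjective P)
  have hsurj := bimodTensorMap_surjective R S ω (augmentation_surjective P)
  change Function.Exact (bimodTensorMap R S ω (P.complex.d 1 0).hom)
    (bimodTensorMap R S ω (f ∘ₗ (augmentation P).hom)) ↔ _
  rw [bimodTensorMap_comp]
  constructor
  · intro hE
    refine (injective_iff_map_eq_zero _).2 fun x hx => ?_
    obtain ⟨y, rfl⟩ := hsurj x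
    exact (hex y).2 ((hE y).1 hx)
  · intro hf y
    rw [← hex y, LinearMap.comp_apply, map_eq_zero_iff _ hf]

end Tor

/-! ### The functor `Hom_R(ω, -)`, sums of copies of `ω`, and the evaluation map -/

section HomFrom

variable (R S ω : Type u) [Ring R] [Ring S] [AddCommGroup ω] [Module R ω] [Module Sᵐᵒᵖ ω]
  [SMulCommClass R Sᵐᵒᵖ ω]

/-- Evaluation at `x` as an additive map on `Hom_R(ω, M)`. -/
def HomFrom.eval {M : Type u} [AddCommGroup M] [Module R M] (x : ω) : HomFrom R S ω M →+ M where
  toFun f := (show ω →ₗ[R] M from f) x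
  map_zero' := rfl
  map_add' _ _ := rfl

/-- The map `Hom_R(ω, g)`. -/
def HomFrom.map {M M' : Type u} [AddCommGroup M] [Module R M] [AddCommGroup M'] [Module R M']
    (g : M →ₗ[R] M') : HomFrom R S ω M →ₗ[S] HomFrom R S ω M' where
  toFun f := g ∘ₗ (show ω →ₗ[R] M from f)
  map_add' _ _ := LinearMap.ext fun _ => map_add g _ _
  map_smul' _ _ := rfl

theorem IsSES.homFrom {X₁ X₂ X₃ : Type u} [AddCommGroup X₁] [Module R X₁] [AddCommGroup X₂]
    [Module R X₂] [AddCommGroup X₃] [Module R X₃] {f : X₁ →ₗ[R] X₂} {g : X₂ →ₗ[R] X₃}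
    (h : IsSES f g) (hl : ∀ u : ω →ₗ[R] X₃, ∃ v : ω →ₗ[R] X₂, g ∘ₗ v = u) :
    IsSES (HomFrom.map R S ω f) (HomFrom.map R S ω g) where
  inj u v huv := LinearMap.ext fun x => h.inj (LinearMap.congr_fun (f := f ∘ₗ _) huv x)
  surj := hl
  exact u := by
    constructor
    · intro hu
      let u' : ω →ₗ[R] X₂ := u
      have hk (x : ω) : u' x ∈ LinearMap.range f :=
        (h.exact _).1 (LinearMap.congr_fun (f := g ∘ₗ u') hu x)
      let e := LinearEquiv.ofInjective f h.inj
      refine ⟨(e.symm.toLinearMap ∘ₗ u'.codRestrict _ hk : ω →ₗ[R] X₁), LinearMap.ext fun x => ?_⟩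
      exact congrArg Subtype.val (e.apply_symm_apply ⟨u' x, hk x⟩)
    · rintro ⟨v, rfl⟩
      exact LinearMap.ext fun x => h.exact.apply_apply_eq_zero _

theorem theta_comp_bimodTensorMap {M M' : Type u} [AddCommGroup M] [Module R M] [AddCommGroup M']
    [Module R M'] (g : M →ₗ[R] M') (t : BimodTensor R S ω (HomFrom R S ω M)) :
    theta R S ω M' (bimodTensorMap R S ω (HomFrom.map R S ω g) t) = g (theta R S ω M t) := by
  have : theta R S ω M' ∘ₗ bimodTensorMap R S ω (HomFrom.map R S ω g) = g ∘ₗ theta R S ω M :=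
    bimodTensor_ext R S ω fun _ _ => rfl
  exact LinearMap.congr_fun this t

variable (I : Type u)

/-- The inclusion of a summand, as an element of `Hom_R(ω, ω^(I))`. -/
def HomFrom.single (i : I) : HomFrom R S ω (I →₀ ω) := (Finsupp.lsingle i : ω →ₗ[R] I →₀ ω)

theorem HomFrom.eval_linearCombination_single (c : I →₀ S) (x : ω) (i : I) :
    HomFrom.eval R S ω x (Finsupp.linearCombination S (HomFrom.single R S ω I) c) i =
      MulOpposite.op (c i) • x := by
  classical
  induction c using Finsupp.induction_linear with
  | zero => simp
  | add c d hc hd => simp [map_add, hc, hd, add_smul]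
  | single j s =>
    rw [Finsupp.linearCombination_single]
    change Finsupp.single j (MulOpposite.op s • x) i = _
    by_cases h : j = i
    · subst h; simp
    · simp [Finsupp.single_eq_of_ne' h]

variable {R S ω}

/-- The inclusions of the summands form an `S`-basis: a map from the finitely generated `ω` meets
finitely many summands, and each component is an endomorphism of `ω`, hence an element of `S`. -/
theorem HomFrom.linearCombination_single_bijective [Module.Finite R ω]
    (hω : Function.Bijective (homothetyRight R S ω)) :
    Function.Bijective (Finsupp.linearCombination S (HomFrom.single R S ω I)) := by
  constructor
  · refine (injective_iff_map_eq_zero _).2 fun c hc => Finsupp.ext fun i => hω.1 ?_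
    refine LinearMap.ext fun x => ?_
    have := HomFrom.eval_linearCombination_single R S ω I c x i
    rw [hc, map_zero] at this
    change MulOpposite.op (c i) • x = MulOpposite.op (0 : S) • x
    rw [← this]
    simp
  · intro f
    let f' : ω →ₗ[R] I →₀ ω := f
    obtain ⟨T, hT⟩ := exists_finset_support_subset f'
    choose s hs using fun i : I => hω.2 (Finsupp.lapply i ∘ₗ f')
    have hs' (i : I) (x : ω) : MulOpposite.op (s i) • x = f' x i := LinearMap.congr_fun (hs i) x
    refine ⟨Finsupp.onFinset T s fun i => ?_, LinearMap.ext fun x => Finsupp.ext fun i => ?_⟩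
    · contrapose!
      intro hi
      refine hω.1 (LinearMap.ext fun x => (hs' i x).trans ?_)
      change _ = MulOpposite.op (0 : S) • x
      rw [Finsupp.notMem_support_iff.1 fun h => hi (hT x h)]
      simp
    · exact (HomFrom.eval_linearCombination_single R S ω I _ x i).trans (hs' i x)

theorem HomFrom.projective_finsupp [Module.Finite R ω]
    (hω : Function.Bijective (homothetyRight R S ω)) :
    Module.Projective S (HomFrom R S ω (I →₀ ω)) :=
  .of_equiv (LinearEquiv.ofBijective _ (HomFrom.linearCombination_single_bijective I hω))

theorem theta_finsupp_bijective [Module.Finite R ω]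
    (hω : Function.Bijective (homothetyRight R S ω)) :
    Function.Bijective (theta R S ω (I →₀ ω)) := by
  constructor
  -- The left inverse of `θ` sends `x` in the summand `i` to `x ⊗ ι_i`, with `ι_i` the inclusion of
  -- that summand.
  · let j (i : I) : ω →ₗ[R] BimodTensor R S ω (HomFrom R S ω (I →₀ ω)) :=
      { toFun := fun x => Submodule.Quotient.mk (x ⊗ₜ HomFrom.single R S ω I i)
        map_add' := fun x y => by rw [TensorProduct.add_tmul, Submodule.Quotient.mk_add]
        map_smul' := fun r x => by
          rw [← TensorProduct.smul_tmul', Submodule.Quotient.mk_smul]; rfl }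
    have : (Finsupp.lsum ℕ j) ∘ₗ theta R S ω (I →₀ ω) = LinearMap.id := by
      refine bimodTensor_ext R S ω fun x f => ?_
      obtain ⟨c, rfl⟩ := (HomFrom.linearCombination_single_bijective I hω).2 f
      change Finsupp.lsum ℕ j (HomFrom.eval R S ω x _) = Submodule.Quotient.mk _
      induction c using Finsupp.induction_linear with
      | zero => simp
      | add c d hc hd =>
        rw [map_add, map_add, map_add, hc, hd, TensorProduct.tmul_add, Submodule.Quotient.mk_add]
      | single i s =>
        rw [Finsupp.linearCombination_single]
        change Finsupp.lsum ℕ j (Finsupp.single i (MulOpposite.op s • x)) = _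
        rw [Finsupp.lsum_single]
        exact (Submodule.Quotient.eq _).2 (Submodule.subset_span ⟨_, _, _, rfl⟩)
    exact Function.LeftInverse.injective (g := Finsupp.lsum ℕ j) (LinearMap.congr_fun this)
  · rw [← LinearMap.range_eq_top, eq_top_iff, ← Finsupp.iSup_lsingle_range (R := R), iSup_le_iff]
    rintro i _ ⟨x, rfl⟩
    exact ⟨Submodule.Quotient.mk (x ⊗ₜ HomFrom.single R S ω I i), rfl⟩

section Diagram

variable {I} [Module.Finite R ω] (hω : Function.Bijective (homothetyRight R S ω))
  {L M : Type u} [AddCommGroup L] [Module R L] [AddCommGroup M] [Module R M]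
  {f : L →ₗ[R] (I →₀ ω)} {g : (I →₀ ω) →ₗ[R] M} (h : IsSES f g)
  (hl : ∀ u : ω →ₗ[R] M, ∃ v : ω →ₗ[R] (I →₀ ω), g ∘ₗ v = u)

include hω h

theorem IsSES.theta_surjective : Function.Surjective (theta R S ω M) := by
  intro m
  obtain ⟨w, rfl⟩ := h.surj m
  obtain ⟨t, rfl⟩ := (theta_finsupp_bijective I hω).2 w
  exact ⟨_, theta_comp_bimodTensorMap R S ω g t⟩

include hl

/-- A diagram chase: `θ` maps the right exact row `ω ⊗ Hom(ω, L) → ω ⊗ Hom(ω, ω^(I)) → ω ⊗ Hom(ω, M)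
→ 0` to the given sequence and is bijective in the middle. -/
theorem IsSES.theta_injective_iff :
    Function.Injective (theta R S ω M) ↔ Function.Surjective (theta R S ω L) := by
  have hN := h.homFrom R S ω hl
  have hT := bimodTensorMap_exact R S ω hN.exact hN.surj
  have hθ := theta_finsupp_bijective I hω
  constructor
  · intro hM l
    obtain ⟨s, hs⟩ := hθ.2 (f l)
    obtain ⟨r, rfl⟩ := (hT s).1 (hM (by
      rw [theta_comp_bimodTensorMap, hs, h.exact.apply_apply_eq_zero, map_zero]))
    exact ⟨r, h.inj (by rw [← theta_comp_bimodTensorMap, hs])⟩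
  · intro hL
    refine (injective_iff_map_eq_zero _).2 fun t ht => ?_
    obtain ⟨s, rfl⟩ := bimodTensorMap_surjective R S ω hN.surj t
    rw [theta_comp_bimodTensorMap] at ht
    obtain ⟨l, hl'⟩ := (h.exact _).1 ht
    obtain ⟨r, rfl⟩ := hL l
    rw [← theta_comp_bimodTensorMap] at hl'
    rw [← hθ.1 hl', hT.apply_apply_eq_zero]

/-- As the middle term `Hom(ω, ω^(I))` is projective, `Tor_1` measures injectivity of `ω ⊗ Hom(ω,
f)`. Following this map by the bijective `θ` gives `f ∘ θ_L`, with `f` injective. -/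
theorem IsSES.tor_one_homFrom :
    Subsingleton (tor R S ω 1 (ModuleCat.of S (HomFrom R S ω M))) ↔
      Function.Injective (theta R S ω L) := by
  have := HomFrom.projective_finsupp I hω
  rw [(h.homFrom R S ω hl).tor_one R S ω, ← (theta_finsupp_bijective I hω).1.of_comp_iff,
    ← h.inj.of_comp_iff (theta R S ω L)]
  exact iff_of_eq (congrArg _ (funext fun t => theta_comp_bimodTensorMap R S ω f t))

theorem IsSES.tor_succ_homFrom (i : ℕ) :
    Subsingleton (tor R S ω (i + 2) (ModuleCat.of S (HomFrom R S ω M))) ↔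
      Subsingleton (tor R S ω (i + 1) (ModuleCat.of S (HomFrom R S ω L))) := by
  have := HomFrom.projective_finsupp I hω
  exact (h.homFrom R S ω hl).tor_succ R S ω i

end Diagram

end HomFrom

/-! ### The Bass class as the largest class with covers by sums of `ω` -/

section Covers

variable {R S ω : Type u} [Ring R] [Ring S] [AddCommGroup ω] [Module R ω] [Module Sᵐᵒᵖ ω]
  [SMulCommClass R Sᵐᵒᵖ ω]

/-- Every module in the class `Z` lies in `ω^⊥` and is the quotient of a direct sum of copies of
`ω` by a submodule which lies again in `Z`. -/
def HasCovers (R ω : Type u) [Ring R] [AddCommGroup ω] [Module R ω]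
    (Z : ObjectProperty (ModuleCat.{u} R)) : Prop :=
  ∀ X, Z X → extPerp R ω X ∧ ∃ (I : Type u) (g : (I →₀ ω) →ₗ[R] X),
    Function.Surjective g ∧ Z (ModuleCat.of R (LinearMap.ker g))

theorem IsSemidualizing.isFPInfty_left (hω : IsSemidualizing R S ω) : IsFPInfty R ω :=
  hω.finite_left.isFPInfty

theorem IsSemidualizing.isFPInfty_right (hω : IsSemidualizing R S ω) : IsFPInfty Sᵐᵒᵖ ω :=
  hω.finite_right.isFPInfty

/-- Every member has surjective `θ`, being a quotient of `ω^(I)`. Applied to the kernel of a cover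
this gives injectivity as well. Bijectivity on kernels then kills `Tor_1`, and induction the higher
Tor. -/
theorem HasCovers.le_bassClass (hω : IsSemidualizing R S ω) {Z : ObjectProperty (ModuleCat.{u} R)}
    (hZ : HasCovers R ω Z) : Z ≤ bassClass R S ω := by
  have := hω.isFPInfty_left.finite
  have hr := hω.homothety_right
  have hsurj (X) (hX : Z X) : Function.Surjective (theta R S ω X) := by
    obtain ⟨I, g, hg, hk⟩ := (hZ X hX).2
    exact (isSES_ker hg).theta_surjective hr
  have hbij (X) (hX : Z X) : Function.Bijective (theta R S ω X) := by
    obtain ⟨I, g, hg, hk⟩ := (hZ X hX).2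
    have hl := (isSES_ker hg).lift_of_ext ((hZ _ hk).1 1 le_rfl)
    exact ⟨((isSES_ker hg).theta_injective_iff hr hl).2 (hsurj _ hk), hsurj X hX⟩
  intro X hX
  refine ⟨(hZ X hX).1, fun i hi => ?_, hbij X hX⟩
  induction i, hi using Nat.le_induction generalizing X with
  | base =>
    obtain ⟨I, g, hg, hk⟩ := (hZ X hX).2
    have hl := (isSES_ker hg).lift_of_ext ((hZ _ hk).1 1 le_rfl)
    exact ((isSES_ker hg).tor_one_homFrom hr hl).2 (hbij _ hk).1
  | succ i hi ih =>
    obtain ⟨I, g, hg, hk⟩ := (hZ X hX).2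
    have hl := (isSES_ker hg).lift_of_ext ((hZ _ hk).1 1 le_rfl)
    obtain ⟨i, rfl⟩ := Nat.exists_eq_add_of_le' hi
    exact (IsSES.tor_succ_homFrom (L := LinearMap.ker g) hr (isSES_ker hg) hl i).2
      (ih (ModuleCat.of R (LinearMap.ker g)) hk)

/-- The sum of all homomorphisms from `ω` to `M`. -/
def evaluation (R ω M : Type u) [Ring R] [AddCommGroup ω] [Module R ω] [AddCommGroup M]
    [Module R M] : ((ω →ₗ[R] M) →₀ ω) →ₗ[R] M :=
  Finsupp.lsum ℕ fun u => u

theorem evaluation_single {M : Type u} [AddCommGroup M] [Module R M] (u : ω →ₗ[R] M) (x : ω) :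
    evaluation R ω M (Finsupp.single u x) = u x :=
  Finsupp.lsum_single ..

theorem evaluation_lift {M : Type u} [AddCommGroup M] [Module R M] (u : ω →ₗ[R] M) :
    ∃ v : ω →ₗ[R] ((ω →ₗ[R] M) →₀ ω), evaluation R ω M ∘ₗ v = u :=
  ⟨Finsupp.lsingle u, LinearMap.ext fun x => evaluation_single u x⟩

theorem IsSemidualizing.extVanish_finsupp (hω : IsSemidualizing R S ω) (I : Type u) :
    ExtVanish R ω (I →₀ ω) :=
  hω.isFPInfty_left.extVanish_finsupp hω.ext_left I

theorem extVanish_ker_evaluation (hω : IsSemidualizing R S ω) {M : Type u} [AddCommGroup M]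
    [Module R M] (hM : ExtVanish R ω M) (hs : Function.Surjective (evaluation R ω M)) :
    ExtVanish R ω (LinearMap.ker (evaluation R ω M)) :=
  (isSES_ker hs).extVanish_left (hω.extVanish_finsupp _) hM evaluation_lift

/-- The cover is the sum of all maps `ω → X`. It is onto because `θ` is, and all maps `ω → X` lift
through it, which keeps its kernel in `ω^⊥`. -/
theorem hasCovers_bassClass (hω : IsSemidualizing R S ω) :
    HasCovers R ω (bassClass R S ω) := by
  have := hω.isFPInfty_left.finite
  have hr := hω.homothety_right
  intro X hX
  have hs : Function.Surjective (evaluation R ω X) := by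
    have : LinearMap.range (theta R S ω X) ≤ LinearMap.range (evaluation R ω X) := by
      rintro _ ⟨t, rfl⟩
      obtain ⟨t, rfl⟩ := Submodule.Quotient.mk_surjective _ t
      induction t using TensorProduct.induction_on with
      | zero => simp
      | tmul x f => exact ⟨Finsupp.single f x, evaluation_single f x⟩
      | add a b ha hb => rw [Submodule.Quotient.mk_add, map_add]; exact add_mem ha hb
    rw [← LinearMap.range_eq_top, eq_top_iff]
    exact (LinearMap.range_eq_top.2 hX.2.2.2).ge.trans this
  have h := isSES_ker hs
  refine ⟨hX.1, _, _, hs, extVanish_ker_evaluation hω hX.1 hs, fun i hi => ?_,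
    (h.tor_one_homFrom hr evaluation_lift).1 (hX.2.1 1 le_rfl),
    (h.theta_injective_iff hr evaluation_lift).1 hX.2.2.1⟩
  obtain ⟨i, rfl⟩ := Nat.exists_eq_add_of_le' hi
  exact (h.tor_succ_homFrom hr evaluation_lift i).1 (hX.2.1 _ (by omega))

/-- A horseshoe argument: the cover of `X''` lifts to `E` since `Ext^1(ω, X') = 0`, and the kernel
of the combined cover is an extension of the two kernels. By maximality the Bass class is then
closed under extensions. -/
theorem HasCovers.extension {Z : ObjectProperty (ModuleCat.{u} R)} (hZ : HasCovers R ω Z) :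
    HasCovers R ω fun E => ∃ (X' X'' : ModuleCat.{u} R) (f : X' →ₗ[R] E) (g : E →ₗ[R] X''),
      Z X' ∧ Z X'' ∧ IsSES f g := by
  rintro E ⟨X', X'', f, g, hX', hX'', h⟩
  obtain ⟨hX', I', g', hg', hk'⟩ := hZ X' hX'
  obtain ⟨hX'', I'', g'', hg'', hk''⟩ := hZ X'' hX''
  refine ⟨h.extVanish_middle hX' hX'', I' ⊕ I'', ?_⟩
  choose v hv using fun i : I'' => h.lift_of_ext (hX' 1 le_rfl) (g'' ∘ₗ Finsupp.lsingle i)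
  let w : (I'' →₀ ω) →ₗ[R] E := Finsupp.lsum ℕ v
  have hw (y) : g (w y) = g'' y := by
    have : g ∘ₗ w = g'' := Finsupp.lhom_ext fun i x => by
      simpa [w] using LinearMap.congr_fun (hv i) x
    exact LinearMap.congr_fun this y
  let e := Finsupp.sumFinsuppLEquivProdFinsupp R (α := I') (β := I'') (M := ω)
  let p : (I' ⊕ I'' →₀ ω) →ₗ[R] E := (LinearMap.coprod (f ∘ₗ g') w) ∘ₗ e.toLinearMap
  have hp (y) : p y = f (g' (e y).1) + w (e y).2 := rfl
  have hp' (y) : p (e.symm y) = f (g' y.1) + w y.2 := by rw [hp, e.apply_symm_apply]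
  refine ⟨p, fun x => ?_, ModuleCat.of R (LinearMap.ker g'), ModuleCat.of R (LinearMap.ker g''),
    LinearMap.codRestrict _ (e.symm.toLinearMap ∘ₗ LinearMap.inl R _ _ ∘ₗ
      (LinearMap.ker g').subtype) fun y => ?_,
    LinearMap.codRestrict _ (LinearMap.snd R _ _ ∘ₗ e.toLinearMap ∘ₗ
      (LinearMap.ker p).subtype) fun y => ?_, hk', hk'', ?_, ?_, ?_⟩
  · obtain ⟨y, hy⟩ := hg'' (g x)
    obtain ⟨z, hz⟩ := (h.exact (x - w y)).1 (by rw [map_sub, hw, hy, sub_self])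
    obtain ⟨z, rfl⟩ := hg' z
    exact ⟨e.symm (z, y), by rw [hp', hz, sub_add_cancel]⟩
  · change p (e.symm (y.1, 0)) = 0
    rw [hp', LinearMap.mem_ker.1 y.2]
    simp
  · have := congrArg g (LinearMap.mem_ker.1 y.2)
    rw [hp, map_add, h.exact.apply_apply_eq_zero, zero_add, hw, map_zero] at this
    exact this
  · intro y z hyz
    have := e.symm.injective (congrArg Subtype.val hyz)
    exact Subtype.ext (congrArg Prod.fst this)
  · intro y
    constructor
    · intro hy
      have hy2 : (e y.1).2 = 0 := congrArg Subtype.val hy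
      have hy1 : g' (e y.1).1 = 0 := h.inj (by
        have := LinearMap.mem_ker.1 y.2
        rwa [hp, hy2, map_zero, add_zero, ← map_zero f] at this)
      refine ⟨⟨_, hy1⟩, Subtype.ext ?_⟩
      change e.symm ((e y.1).1, 0) = y.1
      rw [← hy2]
      exact e.symm_apply_apply _
    · rintro ⟨z, rfl⟩
      refine Subtype.ext ?_
      change (e (e.symm (z.1, 0))).2 = 0
      rw [e.apply_symm_apply]
  · intro y
    obtain ⟨z, hz⟩ := (h.exact (w y.1)).1 (by rw [hw, LinearMap.mem_ker.1 y.2])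
    obtain ⟨z, rfl⟩ := hg' z
    -- The lift `w y` need not vanish in `E`, but it comes from `X'`; the component `-z` cancels it.
    refine ⟨⟨e.symm (-z, y.1), ?_⟩, Subtype.ext ?_⟩
    · rw [LinearMap.mem_ker, hp', map_neg, map_neg, hz, neg_add_cancel]
    · change (e (e.symm (-z, y.1))).2 = _
      rw [e.apply_symm_apply]

theorem IsSES.bassClass_middle (hω : IsSemidualizing R S ω) {X' E X'' : ModuleCat.{u} R}
    {f : X' →ₗ[R] E} {g : E →ₗ[R] X''} (h : IsSES f g) (hX' : bassClass R S ω X')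
    (hX'' : bassClass R S ω X'') : bassClass R S ω E :=
  (hasCovers_bassClass hω).extension.le_bassClass hω E ⟨X', X'', f, g, hX', hX'', h⟩

end Covers

/-! ### Exactness of `Hom(-, Y)` and its values on finitely generated projectives -/

section Precomposition

variable {A : Type u} (B : Type u) [Ring A] [Ring B] {X₁ X₂ X₃ : Type u} [AddCommGroup X₁]
  [Module A X₁] [AddCommGroup X₂] [Module A X₂] [AddCommGroup X₃] [Module A X₃]
  (Y : Type u) [AddCommGroup Y] [Module A Y] [Module B Y] [SMulCommClass A B Y]

/-- The map `Hom_A(f, Y)`, linear for a further ring `B` acting on `Y`. -/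
def precomp (f : X₁ →ₗ[A] X₂) : (X₂ →ₗ[A] Y) →ₗ[B] (X₁ →ₗ[A] Y) where
  toFun u := u ∘ₗ f
  map_add' _ _ := rfl
  map_smul' _ _ := rfl

theorem IsSES.precomp {f : X₁ →ₗ[A] X₂} {g : X₂ →ₗ[A] X₃} (h : IsSES f g)
    (hY : ∀ u : X₁ →ₗ[A] Y, ∃ v : X₂ →ₗ[A] Y, v ∘ₗ f = u) :
    IsSES (precomp B Y g) (precomp B Y f) where
  inj u v huv := LinearMap.ext fun x => by
    obtain ⟨x, rfl⟩ := h.surj x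
    exact LinearMap.congr_fun (f := u ∘ₗ g) huv x
  surj := hY
  exact u := by
    constructor
    · intro hu
      have hk : LinearMap.ker g ≤ LinearMap.ker u := by
        intro x hx
        obtain ⟨y, rfl⟩ := (h.exact x).1 hx
        exact LinearMap.congr_fun (f := u ∘ₗ f) hu y
      exact exists_comp_eq_of_ker_le h.surj u hk
    · rintro ⟨v, rfl⟩
      exact LinearMap.ext fun x =>
        (congrArg v (h.exact.apply_apply_eq_zero x)).trans (map_zero v)

/-- A finite dual basis `(p_j, σ_j)` of `P` gives `φ ↦ (φ(p_j))_j` and its retraction `w ↦ ∑ σ_j(-)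
w_j`. -/
theorem exists_retract_finsupp (P : Type u) [AddCommGroup P] [Module A P] [Module.Finite A P]
    [Module.Projective A P] : ∃ (I : Type u) (i : (P →ₗ[A] Y) →ₗ[B] (I →₀ Y))
      (r : (I →₀ Y) →ₗ[B] (P →ₗ[A] Y)), r ∘ₗ i = LinearMap.id := by
  obtain ⟨n, p, hp⟩ := Module.Finite.exists_fin (R := A) (M := P)
  have hs : Function.Surjective (Finsupp.linearCombination A fun j : ULift.{u} (Fin n) =>
      p j.down) := by
    rw [← LinearMap.range_eq_top, Finsupp.range_linearCombination, ← hp]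
    congr 1
    exact ULift.down_surjective.range_comp p
  obtain ⟨σ, hσ⟩ := Module.projective_lifting_property _ LinearMap.id hs
  have hσ' (x : P) : ∑ j : ULift.{u} (Fin n), σ x j • p j.down = x := by
    have := LinearMap.congr_fun hσ x
    rwa [LinearMap.comp_apply, Finsupp.linearCombination_apply,
      Finsupp.sum_fintype _ (fun (j : ULift.{u} (Fin n)) (a : A) => a • p j.down)
        (fun _ => zero_smul _ _)] at this
  refine ⟨ULift.{u} (Fin n),
    { toFun := fun φ => Finsupp.equivFunOnFinite.symm fun j => φ (p j.down)
      map_add' := fun _ _ => Finsupp.ext fun _ => rfl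
      map_smul' := fun _ _ => Finsupp.ext fun _ => rfl },
    { toFun := fun w =>
        { toFun := fun x => ∑ j, σ x j • w j
          map_add' := fun x y => by simp [add_smul, Finset.sum_add_distrib]
          map_smul' := fun a x => by simp [mul_smul, Finset.smul_sum] }
      map_add' := fun w z => LinearMap.ext fun x => by simp [Finset.sum_add_distrib]
      map_smul' := fun b w => LinearMap.ext fun x => by simp [Finset.smul_sum, smul_comm] }, ?_⟩
  refine LinearMap.ext fun φ => LinearMap.ext fun x => ?_
  change ∑ j, σ x j • φ (p j.down) = φ x
  conv_rhs => rw [← hσ' x]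
  simp

end Precomposition

/-! ### Building and cutting finite coresolutions -/

section Coresolutions

variable {R : Type u} [Ring R] {X : ObjectProperty (ModuleCat.{u} R)}

theorem hasCoresolution_zero {M : ModuleCat.{u} R} (hM : X M) : HasCoresolution X M 0 := by
  refine ⟨fun i => i.casesOn M fun _ => ModuleCat.of R PUnit, LinearMap.id, fun i => 0, ?_, ?_,
    Function.injective_id, ?_, ?_⟩
  · intro i hi
    obtain rfl : i = 0 := by omega
    exact hM
  · intro i hi
    obtain ⟨i, rfl⟩ := Nat.exists_eq_add_of_lt hi
    rw [zero_add]
    exact inferInstanceAs (Subsingleton PUnit)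
  · exact fun x => ⟨fun _ => ⟨x, rfl⟩, fun _ => rfl⟩
  · exact fun i x => ⟨fun _ => ⟨0, Subsingleton.elim (α := PUnit) _ _⟩, fun _ => rfl⟩

theorem HasCoresolution.cons {M C₀ L : ModuleCat.{u} R} {f : M →ₗ[R] C₀} {g : C₀ →ₗ[R] L}
    (h : IsSES f g) (hC : X C₀) {n : ℕ} (hL : HasCoresolution X L n) :
    HasCoresolution X M (n + 1) := by
  obtain ⟨C, ε, d, h₁, h₂, h₃, h₄, h₅⟩ := hL
  refine ⟨fun i => i.casesOn C₀ C, f, fun i => match i with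
    | 0 => ε ∘ₗ g
    | i + 1 => d i, ?_, ?_, h.inj, ?_, ?_⟩
  · rintro (_ | i) hi
    · exact hC
    · exact h₁ i (by omega)
  · rintro (_ | i) hi
    · omega
    · exact h₂ i (by omega)
  · intro x
    exact (map_eq_zero_iff ε h₃).trans (h.exact x)
  · rintro (_ | i)
    · intro x
      refine (h₄ x).trans ⟨?_, ?_⟩
      · rintro ⟨y, rfl⟩
        obtain ⟨z, rfl⟩ := h.surj y
        exact ⟨z, rfl⟩
      · rintro ⟨z, rfl⟩
        exact ⟨g z, rfl⟩
    · exact h₅ i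

theorem HasCoresolution.of_zero {M : ModuleCat.{u} R} (h : HasCoresolution X M 0) :
    ∃ C₀ : ModuleCat.{u} R, X C₀ ∧ Nonempty (M ≃ₗ[R] C₀) := by
  obtain ⟨C, ε, d, h₁, h₂, h₃, h₄, h₅⟩ := h
  have := h₂ 1 one_pos
  exact ⟨C 0, h₁ 0 le_rfl, ⟨LinearEquiv.ofBijective ε
    ⟨h₃, fun x => (h₄ x).1 (Subsingleton.elim _ _)⟩⟩⟩

theorem HasCoresolution.of_succ {M : ModuleCat.{u} R} {n : ℕ}
    (h : HasCoresolution X M (n + 1)) :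
    ∃ (C₀ L : ModuleCat.{u} R) (f : M →ₗ[R] C₀) (g : C₀ →ₗ[R] L), X C₀ ∧ IsSES f g ∧
      HasCoresolution X L n := by
  obtain ⟨C, ε, d, h₁, h₂, h₃, h₄, h₅⟩ := h
  refine ⟨C 0, ModuleCat.of R (LinearMap.range (d 0)), ε, (d 0).rangeRestrict, h₁ 0 (by omega),
    ⟨h₃, fun x => ?_, LinearMap.surjective_rangeRestrict _⟩, fun i => C (i + 1),
    (LinearMap.range (d 0)).subtype, fun i => d (i + 1), fun i hi => h₁ _ (by omega),
    fun i hi => h₂ _ (by omega), Subtype.val_injective, fun x => ?_, fun i => h₅ _⟩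
  · rw [← h₄ x]
    exact Subtype.ext_iff
  · rw [h₅ 0 x]
    exact ⟨fun ⟨y, hy⟩ => ⟨⟨x, y, hy⟩, rfl⟩, fun ⟨y, hy⟩ => hy ▸ y.2⟩

theorem relInjDim_le_iff {M : ModuleCat.{u} R} {n : ℕ} :
    relInjDim X M ≤ n ↔ ∃ m ≤ n, HasCoresolution X M m := by
  constructor
  · intro h
    by_contra! hc
    have : ((n + 1 : ℕ) : ℕ∞) ≤ relInjDim X M := by
      refine le_iInf₂ fun m hm => ?_
      exact_mod_cast not_le.1 fun hmn => hc m hmn hm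
    have := this.trans h
    norm_cast at this
    omega
  · rintro ⟨m, hm, h⟩
    exact (iInf₂_le m h).trans (by exact_mod_cast hm)

theorem HasCoresolution.of_linearEquiv {M M' : ModuleCat.{u} R} (e : M' ≃ₗ[R] M) {n : ℕ}
    (h : HasCoresolution X M n) : HasCoresolution X M' n := by
  obtain ⟨C, ε, d, h₁, h₂, h₃, h₄, h₅⟩ := h
  refine ⟨C, ε ∘ₗ e.toLinearMap, d, h₁, h₂, h₃.comp e.injective, fun x => ?_, h₅⟩
  rw [h₄ x]
  exact e.surjective.range_comp ε ▸ Iff.rfl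

end Coresolutions

/-! ### Right semi-tilting bimodules: dualizing the resolution of `ω` over `S^op` -/

section SemiTilting

variable {R S ω : Type u} [Ring R] [Ring S] [AddCommGroup ω] [Module R ω] [Module Sᵐᵒᵖ ω]
  [SMulCommClass Sᵐᵒᵖ R ω]

theorem IsSES.hasProjectiveDimensionLT_left {A : Type u} [Ring A] {X₁ X₂ X₃ : Type u}
    [AddCommGroup X₁] [Module A X₁] [AddCommGroup X₂] [Module A X₂] [AddCommGroup X₃]
    [Module A X₃] {f : X₁ →ₗ[A] X₂} {g : X₂ →ₗ[A] X₃} (h : IsSES f g) [Module.Projective A X₂]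
    (n : ℕ) : HasProjectiveDimensionLT (ModuleCat.of A X₃) (n + 2) ↔
      HasProjectiveDimensionLT (ModuleCat.of A X₁) (n + 1) :=
  h.shortExact.hasProjectiveDimensionLT_X₃_iff n ((IsProjective.iff_projective X₂).1 inferInstance)

theorem extVanish_hom_of_projective {P M : Type u} [AddCommGroup P] [Module Sᵐᵒᵖ P]
    [Module.Finite Sᵐᵒᵖ P] [Module.Projective Sᵐᵒᵖ P] [AddCommGroup M] [Module R M]
    (hM : ExtVanish R ω M) : ExtVanish R (P →ₗ[Sᵐᵒᵖ] ω) M := by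
  obtain ⟨I, i, r, hri⟩ := exists_retract_finsupp (A := Sᵐᵒᵖ) R ω P
  exact (hM.finsupp_left I).of_retract i r hri

/-- Induction along syzygies: `Ext^1(K, ω) = 0` keeps `0 → Hom(K, ω) → Hom(P, ω) → Hom(ker f, ω) →
0` exact, and vanishing of Ext into `M` passes to the left term. -/
theorem extVanish_hom_of_projectiveDimension {K M : Type u} [AddCommGroup K] [Module Sᵐᵒᵖ K]
    (hK : IsFPInfty Sᵐᵒᵖ K) {n : ℕ}
    (hn : HasProjectiveDimensionLT (ModuleCat.of Sᵐᵒᵖ K) (n + 1)) (hKω : ExtVanish Sᵐᵒᵖ K ω)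
    [AddCommGroup M] [Module R M] (hM : ExtVanish R ω M) :
    ExtVanish R (K →ₗ[Sᵐᵒᵖ] ω) M := by
  induction n generalizing K with
  | zero =>
    have := hK.finite
    have : Module.Projective Sᵐᵒᵖ K := (IsProjective.iff_projective K).2
      (projective_iff_hasProjectiveDimensionLT_one.2 hn)
    exact extVanish_hom_of_projective hM
  | succ n ih =>
    obtain ⟨P, f, _, _, hf, hk⟩ := hK.exists_cover
    have h := isSES_ker hf
    exact (h.precomp R ω (h.extend_of_ext (hKω 1 le_rfl))).extVanish_contra_left
      (extVanish_hom_of_projective hM)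
      (ih hk ((h.hasProjectiveDimensionLT_left n).1 hn)
        (h.extVanish_contra_left extVanish_of_projective hKω))

variable [SMulCommClass R Sᵐᵒᵖ ω]

theorem IsSemidualizing.extPerp_hom_of_projective (hω : IsSemidualizing R S ω) {P : Type u}
    [AddCommGroup P] [Module Sᵐᵒᵖ P] [Module.Finite Sᵐᵒᵖ P] [Module.Projective Sᵐᵒᵖ P] :
    ExtVanish R ω (P →ₗ[Sᵐᵒᵖ] ω) := by
  obtain ⟨I, i, r, hri⟩ := exists_retract_finsupp (A := Sᵐᵒᵖ) R ω P
  exact (hω.extVanish_finsupp I).of_retract_right i r hri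

theorem IsSemidualizing.hasCoresolution_hom (hω : IsSemidualizing R S ω) {K : Type u}
    [AddCommGroup K] [Module Sᵐᵒᵖ K] (hK : IsFPInfty Sᵐᵒᵖ K) {n : ℕ}
    (hn : HasProjectiveDimensionLT (ModuleCat.of Sᵐᵒᵖ K) (n + 1)) (hKω : ExtVanish Sᵐᵒᵖ K ω) :
    HasCoresolution (extPerp R ω) (ModuleCat.of R (K →ₗ[Sᵐᵒᵖ] ω)) n := by
  induction n generalizing K with
  | zero =>
    have := hK.finite
    have : Module.Projective Sᵐᵒᵖ K := (IsProjective.iff_projective K).2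
      (projective_iff_hasProjectiveDimensionLT_one.2 hn)
    exact hasCoresolution_zero hω.extPerp_hom_of_projective
  | succ n ih =>
    obtain ⟨P, f, _, _, hf, hk⟩ := hK.exists_cover
    have h := isSES_ker hf
    exact .cons (C₀ := ModuleCat.of R (P →ₗ[Sᵐᵒᵖ] ω))
      (h.precomp R ω (h.extend_of_ext (hKω 1 le_rfl))) hω.extPerp_hom_of_projective
      (ih hk ((h.hasProjectiveDimensionLT_left n).1 hn)
        (h.extVanish_contra_left extVanish_of_projective hKω))

/-- The homothety isomorphism `R ≅ Hom_{S^op}(ω, ω)`. -/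
def IsSemidualizing.homothetyEquiv (hω : IsSemidualizing R S ω) : R ≃ₗ[R] (ω →ₗ[Sᵐᵒᵖ] ω) :=
  LinearEquiv.ofBijective (σ₁₂ := RingHom.id R)
    { toFun := homothetyLeft R S ω
      map_add' := fun r s => LinearMap.ext fun x => add_smul r s x
      map_smul' := fun r s => LinearMap.ext fun x => (mul_smul r s x : (r * s) • x = r • s • x) } hω.homothety_left

theorem range_le_range_evaluation {M : Type u} [AddCommGroup M] [Module R M] {I : Type u}
    (u : (I →₀ ω) →ₗ[R] M) : LinearMap.range u ≤ LinearMap.range (evaluation R ω M) := by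
  rw [LinearMap.range_eq_map, ← Finsupp.iSup_lsingle_range (R := R), Submodule.map_iSup,
    iSup_le_iff]
  rintro i _ ⟨_, ⟨x, rfl⟩, rfl⟩
  exact ⟨Finsupp.single (u ∘ₗ Finsupp.lsingle i) x, evaluation_single _ _⟩

theorem IsRightSemiTilting.evaluation_surjective (hω : IsRightSemiTilting R S ω) {M : Type u}
    [AddCommGroup M] [Module R M] (hM : ExtVanish R ω M) :
    Function.Surjective (evaluation R ω M) := by
  have hs := hω.semidualizing
  obtain ⟨n, hn⟩ := (projectiveDimension_ne_top_iff _).1 hω.pd_lt_top.ne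
  -- The bound is relaxed by one so that the syzygy has a bound of the form `n + 1`, even when `ω`
  -- is already projective.
  have hn' : HasProjectiveDimensionLT (ModuleCat.of Sᵐᵒᵖ ω) (n + 2) :=
    hasProjectiveDimensionLT_of_ge _ (n + 1) _ (by omega)
  obtain ⟨P, f, _, _, hf, hk⟩ := hs.isFPInfty_right.exists_cover
  have h := isSES_ker hf
  have hd := h.precomp R ω (h.extend_of_ext (hs.ext_right 1 le_rfl))
  have hvan : ExtVanish R (LinearMap.ker f →ₗ[Sᵐᵒᵖ] ω) M :=
    extVanish_hom_of_projectiveDimension hk ((h.hasProjectiveDimensionLT_left n).1 hn')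
      (h.extVanish_contra_left extVanish_of_projective hs.ext_right) hM
  intro m
  -- The map `R → M`, `1 ↦ m`, extends along `R ≅ Hom(ω, ω) → Hom(P, ω)`. So `m` is hit from a
  -- retract of a sum of copies of `ω`.
  obtain ⟨v, hv⟩ := hd.extend_of_ext (hvan 1 le_rfl)
    (LinearMap.toSpanSingleton R M m ∘ₗ hs.homothetyEquiv.symm.toLinearMap)
  obtain ⟨I, i, r, hri⟩ := exists_retract_finsupp (A := Sᵐᵒᵖ) R ω P
  refine range_le_range_evaluation (v ∘ₗ r) ⟨i (precomp R ω f (hs.homothetyEquiv 1)), ?_⟩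
  rw [LinearMap.comp_apply, ← LinearMap.comp_apply r i, hri, LinearMap.id_apply]
  refine (LinearMap.congr_fun hv (hs.homothetyEquiv 1)).trans ?_
  simp

theorem IsRightSemiTilting.bassClass_eq (hω : IsRightSemiTilting R S ω) :
    bassClass R S ω = extPerp R ω := by
  refine le_antisymm (fun X hX => hX.1) (HasCovers.le_bassClass hω.semidualizing fun X hX => ?_)
  have hs := hω.evaluation_surjective hX
  exact ⟨hX, _, _, hs, extVanish_ker_evaluation hω.semidualizing hX hs⟩

theorem IsRightSemiTilting.relInjDim_le (hω : IsRightSemiTilting R S ω) {n : ℕ}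
    (hn : pdRight S ω ≤ n) : relInjDim (bassClass R S ω) (ModuleCat.of R R) ≤ n := by
  have hs := hω.semidualizing
  rw [relInjDim_le_iff, hω.bassClass_eq]
  exact ⟨n, le_rfl, (hs.hasCoresolution_hom hs.isFPInfty_right
    ((projectiveDimension_le_iff _ n).1 hn) hs.ext_right).of_linearEquiv hs.homothetyEquiv⟩

end SemiTilting

open MulOpposite

/-! ### Extension of characters -/

section Descent

theorem exists_character_comp_eq {X Y : Type*} [AddCommGroup X] [AddCommGroup Y] (f : X →+ Y)
    (u : X →+ AddCircle (1 : ℚ)) (h : ∀ x, f x = 0 → u x = 0) :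
    ∃ v : Y →+ AddCircle (1 : ℚ), ∀ x, v (f x) = u x := by
  let f' := f.toIntLinearMap
  obtain ⟨w, hw⟩ := exists_comp_eq_of_ker_le f'.surjective_rangeRestrict u.toIntLinearMap
    (fun x hx => h x (by rwa [LinearMap.ker_rangeRestrict] at hx))
  obtain ⟨v, hv⟩ := CharacterModule.dual_surjective_of_injective (LinearMap.range f').subtype
    Subtype.val_injective w.toAddMonoidHom
  refine ⟨v, fun x => ?_⟩
  exact (DFunLike.congr_fun hv (f'.rangeRestrict x)).trans (LinearMap.congr_fun hw x)

end Descent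

/-! ### Character modules and equational flatness -/

section Dual

variable (S : Type u) [Ring S]

/-- The character group of a right `S`-module `F`, to be regarded as a left `S`-module. -/
@[nolint unusedArguments]
def Dual (S : Type u) [Ring S] (F : Type u) [AddCommGroup F] [Module Sᵐᵒᵖ F] : Type u :=
  F →+ AddCircle (1 : ℚ)

variable {F F' F'' : Type u} [AddCommGroup F] [Module Sᵐᵒᵖ F] [AddCommGroup F'] [Module Sᵐᵒᵖ F']
  [AddCommGroup F''] [Module Sᵐᵒᵖ F'']

instance : AddCommGroup (Dual S F) := inferInstanceAs (AddCommGroup (F →+ AddCircle (1 : ℚ)))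

instance : FunLike (Dual S F) F (AddCircle (1 : ℚ)) :=
  inferInstanceAs (FunLike (F →+ AddCircle (1 : ℚ)) F (AddCircle (1 : ℚ)))

instance : AddMonoidHomClass (Dual S F) F (AddCircle (1 : ℚ)) :=
  inferInstanceAs (AddMonoidHomClass (F →+ AddCircle (1 : ℚ)) F (AddCircle (1 : ℚ)))

theorem Dual.ext {χ ψ : Dual S F} (h : ∀ x, χ x = ψ x) : χ = ψ := DFunLike.ext _ _ h

instance : Module S (Dual S F) where
  smul s χ := AddMonoidHom.comp (show F →+ AddCircle (1 : ℚ) from χ)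
    (DistribSMul.toAddMonoidHom F (op s))
  one_smul χ := Dual.ext S fun x => congrArg χ (one_smul Sᵐᵒᵖ x)
  mul_smul s t χ := Dual.ext S fun x => congrArg χ (mul_smul (op t) (op s) x)
  smul_zero _ := rfl
  smul_add _ _ _ := rfl
  add_smul s t χ := Dual.ext S fun x =>
    (congrArg χ (add_smul (op s) (op t) x)).trans (map_add χ _ _)
  zero_smul χ := Dual.ext S fun x => (congrArg χ (zero_smul Sᵐᵒᵖ x)).trans (map_zero χ)

theorem Dual.smul_apply (s : S) (χ : Dual S F) (x : F) : (s • χ) x = χ (op s • x) := rfl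

/-- Evaluation of characters at `x`. -/
def Dual.evalHom (x : F) : Dual S F →+ AddCircle (1 : ℚ) where
  toFun χ := χ x
  map_zero' := rfl
  map_add' _ _ := rfl

theorem Dual.sum_apply {ι : Type*} (s : Finset ι) (χ : ι → Dual S F) (x : F) :
    (∑ i ∈ s, χ i) x = ∑ i ∈ s, χ i x :=
  map_sum (Dual.evalHom S x) χ s

/-- The map on character modules induced by `f`. -/
def Dual.map (f : F →ₗ[Sᵐᵒᵖ] F') : Dual S F' →ₗ[S] Dual S F where
  toFun χ := AddMonoidHom.comp (show F' →+ AddCircle (1 : ℚ) from χ) f.toAddMonoidHom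
  map_add' _ _ := rfl
  map_smul' s χ := Dual.ext S fun x => congrArg χ (map_smul f (op s) x).symm

theorem IsSES.dual {f : F →ₗ[Sᵐᵒᵖ] F'} {g : F' →ₗ[Sᵐᵒᵖ] F''} (h : IsSES f g) :
    IsSES (Dual.map S g) (Dual.map S f) where
  inj χ ψ hχψ := Dual.ext S fun x => by
    obtain ⟨x, rfl⟩ := h.surj x
    exact DFunLike.congr_fun hχψ x
  surj χ := by
    obtain ⟨v, hv⟩ := exists_character_comp_eq f.toAddMonoidHom χ
      (fun x hx => (congrArg χ (h.inj (hx.trans (map_zero f).symm))).trans (map_zero χ))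
    exact ⟨v, Dual.ext S hv⟩
  exact χ := by
    constructor
    · intro hχ
      obtain ⟨v, hv⟩ := exists_character_comp_eq g.toAddMonoidHom χ (fun x hx => by
        obtain ⟨y, rfl⟩ := (h.exact x).1 hx
        exact DFunLike.congr_fun hχ y)
      exact ⟨v, Dual.ext S hv⟩
    · rintro ⟨ψ, rfl⟩
      exact Dual.ext S fun x => (congrArg ψ (h.exact.apply_apply_eq_zero x)).trans (map_zero ψ)

/-- The equational criterion for flatness of a right module: each solution of a linear equation is
a combination of solutions in `S`. -/
def IsEquationallyFlat (F : Type u) [AddCommGroup F] [Module Sᵐᵒᵖ F] : Prop :=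
  ∀ (ι : Type u) [Fintype ι] (f : ι → F) (a : ι → S), ∑ j, op (a j) • f j = 0 →
    f ∈ AddSubgroup.closure {h : ι → F | ∃ (g : F) (s : ι → S), ∑ j, s j * a j = 0 ∧
      h = fun j => op (s j) • g}

variable {S}

/-- Baer's criterion: `φ : J → F⁺` extends to `S` iff some character `χ` satisfies `χ(x a) =
φ_a(x)`. Such a `χ` exists once each relation `∑ x_a a = 0` forces `∑ φ_a(x_a) = 0`. Flatness
reduces this to `x_a = g s_a` with `∑ s_a a = 0`, where linearity of `φ` applies. -/
theorem IsEquationallyFlat.injective_dual (hF : IsEquationallyFlat S F) :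
    Module.Injective S (Dual S F) := by
  refine Module.Baer.injective fun J φ => ?_
  let Φ : (J →₀ F) →+ F :=
    Finsupp.liftAddHom fun a => DistribSMul.toAddMonoidHom F (op (a : S))
  let Ψ : (J →₀ F) →+ AddCircle (1 : ℚ) :=
    Finsupp.liftAddHom fun a => (show F →+ AddCircle (1 : ℚ) from φ a)
  have hΦ (a : J) (x : F) : Φ (Finsupp.single a x) = op (a : S) • x :=
    Finsupp.liftAddHom_apply_single _ a x
  have hΨ (a : J) (x : F) : Ψ (Finsupp.single a x) = φ a x := Finsupp.liftAddHom_apply_single _ a x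
  obtain ⟨(χ : Dual S F), (hχ : ∀ x, χ (Φ x) = Ψ x)⟩ := exists_character_comp_eq Φ Ψ (by
    intro c hc
    have hc' : ∑ j : c.support, op (j.1 : S) • c j.1 = 0 := by
      rw [Finset.sum_coe_sort c.support fun j => op (j : S) • c j]
      exact hc
    have key (h : c.support → F) (hh : h ∈ AddSubgroup.closure {h : c.support → F |
        ∃ (g : F) (s : c.support → S), ∑ j, s j * (j.1 : S) = 0 ∧
          h = fun j => op (s j) • g}) : ∑ j, φ j.1 (h j) = 0 := by
      induction hh using AddSubgroup.closure_induction with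
      | mem h hh =>
        obtain ⟨g, s, hs, rfl⟩ := hh
        have : ∑ j, s j • j.1 = 0 := Subtype.ext (by simpa using hs)
        calc ∑ j, φ j.1 (op (s j) • g) = (∑ j, s j • φ j.1) g := by rw [Dual.sum_apply]; rfl
          _ = (φ (∑ j, s j • j.1)) g := by rw [map_sum]; simp only [map_smul]
          _ = 0 := by rw [this, map_zero]; rfl
      | zero => simp
      | add h k _ _ hh hk =>
        simp only [Pi.add_apply, map_add, Finset.sum_add_distrib, hh, hk, add_zero]
      | neg h _ hh => simp only [Pi.neg_apply, map_neg, Finset.sum_neg_distrib, hh, neg_zero]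
    have := key _ (hF c.support (fun j => c j.1) (fun j => (j.1 : S)) hc')
    rw [Finset.sum_coe_sort c.support fun j => φ j (c j)] at this
    exact this)
  refine ⟨LinearMap.toSpanSingleton S (Dual S F) χ, fun a ha => Dual.ext S fun x => ?_⟩
  rw [LinearMap.toSpanSingleton_apply, Dual.smul_apply]
  exact (congrArg χ (hΦ ⟨a, ha⟩ x)).symm.trans ((hχ _).trans (hΨ _ _))

theorem isEquationallyFlat_of_projective [Module.Projective Sᵐᵒᵖ F] : IsEquationallyFlat S F := by
  classical
  intro ι _ f a ha
  obtain ⟨σ, hσ⟩ := (Module.projective_def' (R := Sᵐᵒᵖ) (P := F)).1 inferInstance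
  let T : Finset F := Finset.univ.biUnion fun j => (σ (f j)).support
  have hT (j : ι) : (σ (f j)).support ⊆ T :=
    Finset.subset_biUnion_of_mem (fun j => (σ (f j)).support) (Finset.mem_univ j)
  have hf : f = ∑ x ∈ T, fun j => op (unop (σ (f j) x)) • x := by
    funext j
    rw [Finset.sum_apply]
    refine (LinearMap.congr_fun hσ (f j)).symm.trans ?_
    rw [LinearMap.comp_apply, Finsupp.linearCombination_apply]
    exact Finsupp.sum_of_support_subset _ (hT j) _ (fun x _ => zero_smul _ _)
  rw [hf]
  refine sum_mem fun x _ => AddSubgroup.subset_closure ⟨x, fun j => unop (σ (f j) x), ?_, rfl⟩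
  have := congrArg (fun c => unop (c x)) (congrArg σ ha)
  simpa using this

end Dual

/-! ### Flatness of `Hom_R(ω^(I), ω)` over a coherent ring -/

section Coherence

variable {R S ω : Type u} [Ring R] [Ring S] [AddCommGroup ω] [Module R ω] [Module Sᵐᵒᵖ ω]
  [SMulCommClass R Sᵐᵒᵖ ω]

theorem IsLeftCoherent.fg_relations (hS : IsLeftCoherent S) {ι : Type u} [Fintype ι] (a : ι → S) :
    (LinearMap.ker (Fintype.linearCombination S a)).FG := by
  have hr : (LinearMap.range (Fintype.linearCombination S a)).FG := by
    rw [Fintype.range_linearCombination]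
    exact Submodule.fg_span (Set.finite_range a)
  have := hS _ hr
  rw [← LinearMap.ker_rangeRestrict]
  exact Module.FinitePresentation.fg_ker _ (LinearMap.surjective_rangeRestrict _)

/-- Since `Hom_R(ω^(I), ω) ≅ S^I`, a solution of an equation is a family of solutions in `S`, one
for each `i : I`. By coherence all of them are combinations of one finite set `G`, and the
coefficients at each `z ∈ G` assemble into an element of `S^I`. -/
theorem IsLeftCoherent.isEquationallyFlat_hom_finsupp (hS : IsLeftCoherent S)
    (hω : Function.Bijective (homothetyRight R S ω)) (I : Type u) :
    IsEquationallyFlat S ((I →₀ ω) →ₗ[R] ω) := by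
  classical
  intro ι _ f a ha
  obtain ⟨G, hG⟩ := hS.fg_relations a
  choose c hc using fun (j : ι) (i : I) => hω.2 (f j ∘ₗ Finsupp.lsingle i)
  have hc' (j i x) : op (c j i) • x = f j (Finsupp.single i x) := LinearMap.congr_fun (hc j i) x
  have hrel (i : I) : (fun j => c j i) ∈ Submodule.span S (G : Set (ι → S)) := by
    rw [hG, LinearMap.mem_ker, Fintype.linearCombination_apply]
    refine hω.1 (LinearMap.ext fun x => ?_)
    have := LinearMap.congr_fun ha (Finsupp.single i x)
    simp only [LinearMap.sum_apply, LinearMap.smul_apply, ← hc', smul_smul, ← op_mul] at this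
    rw [← Finset.sum_smul, ← Finset.op_sum] at this
    exact this.trans (by change _ = op (0 : S) • x; simp)
  choose b _ hb using fun i => Submodule.mem_span_finset.1 (hrel i)
  have hb' (i : I) (j : ι) : c j i = ∑ z ∈ G, b i z * z j := by
    have := congrFun (hb i) j
    simpa using this.symm
  let g (z : ι → S) : (I →₀ ω) →ₗ[R] ω := Finsupp.lsum ℕ fun i => homothetyRight R S ω (b i z)
  have hf : f = ∑ z ∈ G, fun j => op (z j) • g z := by
    funext j
    refine Finsupp.lhom_ext fun i x => ?_
    rw [← hc', hb', Finset.sum_apply, LinearMap.sum_apply, Finset.op_sum, Finset.sum_smul]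
    refine Finset.sum_congr rfl fun z _ => ?_
    rw [LinearMap.smul_apply, Finsupp.lsum_single, op_mul, mul_smul]
    rfl
  rw [hf]
  refine sum_mem fun z hz => AddSubgroup.subset_closure ⟨g z, z, ?_, rfl⟩
  have : z ∈ LinearMap.ker (Fintype.linearCombination S a) := hG ▸ Submodule.subset_span hz
  simpa [Fintype.linearCombination_apply] using this

end Coherence

/-! ### From injective dimension of the character module to projective dimension -/

section FlatDimension

variable {S K : Type u} [Ring S] [AddCommGroup K] [Module Sᵐᵒᵖ K]

/-- Otherwise a character `χ` of `K^n` kills the subgroup but not `k`. The map `z ↦ (g ↦ χ(g z))`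
from `S^n` to `K⁺` vanishes on the kernel of the relation matrix `S^n → S^m`. By injectivity it
factors through a map `ψ` on `S^m`, whence `χ(k) = ∑_i ψ(e_i)(∑_j r_ij k_j) = 0`. -/
theorem mem_closure_relations_of_injective_dual (hK : Module.Injective S (Dual S K)) {n m : ℕ}
    (k : Fin n → K) (r : Fin m → Fin n → Sᵐᵒᵖ) (hr : ∀ i, ∑ j, r i j • k j = 0) :
    k ∈ AddSubgroup.closure {h : Fin n → K | ∃ (g : K) (z : Fin n → S),
      (∀ i, ∑ j, z j * unop (r i j) = 0) ∧ h = fun j => op (z j) • g} := by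
  classical
  by_contra hk
  set H := AddSubgroup.closure {h : Fin n → K | ∃ (g : K) (z : Fin n → S),
      (∀ i, ∑ j, z j * unop (r i j) = 0) ∧ h = fun j => op (z j) • g}
  obtain ⟨χ₀, hχ₀⟩ := CharacterModule.exists_character_apply_ne_zero_of_ne_zero
    (a := QuotientAddGroup.mk' H k) (by simpa using hk)
  let χ : (Fin n → K) →+ AddCircle (1 : ℚ) :=
    AddMonoidHom.comp (show _ →+ AddCircle (1 : ℚ) from χ₀) (QuotientAddGroup.mk' H)
  have hχ (h : Fin n → K) (hh : h ∈ H) : χ h = 0 := by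
    have : QuotientAddGroup.mk' H h = 0 := by simpa using hh
    exact (congrArg χ₀ this).trans (map_zero χ₀)
  let α : (Fin n → S) →ₗ[S] (Fin m → S) := LinearMap.pi fun i =>
    Fintype.linearCombination S fun j => unop (r i j)
  have hα (z i) : α z i = ∑ j, z j * unop (r i j) := rfl
  let β₀ (z : Fin n → S) : K →+ AddCircle (1 : ℚ) :=
    χ.comp (AddMonoidHom.mk' (fun g j => op (z j) • g) fun g h => funext fun j => smul_add _ _ _)
  let β : (Fin n → S) →ₗ[S] Dual S K :=
    { toFun := β₀
      map_add' := fun y z => Dual.ext S fun g => by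
        change χ _ = χ _ + χ _
        rw [← map_add]
        exact congrArg χ (funext fun j => add_smul (op (y j)) (op (z j)) g)
      map_smul' := fun t z => Dual.ext S fun g =>
        congrArg χ (funext fun j => mul_smul (op (z j)) (op t) g) }
  have hβ (z g) : β z g = χ fun j => op (z j) • g := rfl
  obtain ⟨β', hβ'⟩ := exists_comp_eq_of_ker_le α.surjective_rangeRestrict β (by
    intro z hz
    rw [LinearMap.ker_rangeRestrict, LinearMap.mem_ker] at hz
    refine Dual.ext S fun g => hχ _ (AddSubgroup.subset_closure ⟨g, z, fun i => ?_, rfl⟩)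
    exact congrFun hz i)
  obtain ⟨ψ, hψ⟩ := hK.out (LinearMap.range α).subtype Subtype.val_injective β'
  have hψ' (z) : ψ (α z) = β z :=
    (hψ (α.rangeRestrict z)).trans (LinearMap.congr_fun hβ' z)
  have hsingle (j : Fin n) : χ (Pi.single j (k j)) =
      ∑ i, ψ (Pi.single i 1) (r i j • k j) := by
    have h₁ : β (Pi.single j 1) (k j) = χ (Pi.single j (k j)) := by
      rw [hβ]
      refine congrArg χ (funext fun l => ?_)
      by_cases h : l = j
      · subst h; simp
      · simp [h]
    have h₂ : α (Pi.single j 1) = ∑ i, unop (r i j) • Pi.single i (1 : S) := by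
      funext i
      rw [hα, Finset.sum_apply, Finset.sum_eq_single j, Finset.sum_eq_single i]
      · simp
      · intro b _ hb
        simp [hb.symm]
      · simp
      · intro b _ hb
        simp [hb]
      · simp
    rw [← h₁, ← hψ', h₂, map_sum, Dual.sum_apply]
    refine Finset.sum_congr rfl fun i _ => ?_
    rw [map_smul, Dual.smul_apply, op_unop]
  refine hχ₀ ?_
  change χ k = 0
  rw [← Finset.univ_sum_single k, map_sum, Finset.sum_congr rfl fun j _ => hsingle j,
    Finset.sum_comm]
  refine Finset.sum_eq_zero fun i _ => ?_
  rw [← map_sum, hr, map_zero]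

/-- The tuple of generators is a sum of tuples `x z_j`, up to sign, with `z` solving the defining
relations of `K` in `S`. Each `z` defines a map `K → S` and each `x` a map `S → K`; summing these
composites factors the identity of `K` through a projective module. -/
theorem projective_of_injective_dual [Module.FinitePresentation Sᵐᵒᵖ K]
    (hK : Module.Injective S (Dual S K)) : Module.Projective Sᵐᵒᵖ K := by
  classical
  obtain ⟨n, m, f, g, hf, hfg⟩ := Module.FinitePresentation.exists_fin' Sᵐᵒᵖ K
  let k (j : Fin n) : K := f (Pi.single j 1)
  have hk (y : Fin n → Sᵐᵒᵖ) : f y = ∑ j, y j • k j := by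
    conv_lhs => rw [← Finset.univ_sum_single y, map_sum]
    refine Finset.sum_congr rfl fun j _ => ?_
    rw [← map_smul, ← Pi.single_smul, smul_eq_mul, mul_one]
  have key (h : Fin n → K) (hh : h ∈ AddSubgroup.closure {h : Fin n → K |
      ∃ (x : K) (z : Fin n → S), (∀ i, ∑ j, z j * unop (g (Pi.single i 1) j) = 0) ∧
        h = fun j => op (z j) • x}) :
      ∃ (Q : ModuleCat.{u} Sᵐᵒᵖ) (a : K →ₗ[Sᵐᵒᵖ] Q) (b : Q →ₗ[Sᵐᵒᵖ] K),
        Module.Projective Sᵐᵒᵖ Q ∧ ∀ j, b (a (k j)) = h j := by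
    induction hh using AddSubgroup.closure_induction with
    | mem h hh =>
      obtain ⟨x, z, hz, rfl⟩ := hh
      let u : (Fin n → Sᵐᵒᵖ) →ₗ[Sᵐᵒᵖ] Sᵐᵒᵖ := Fintype.linearCombination Sᵐᵒᵖ fun j => op (z j)
      have hu (y) : u y = ∑ j, y j * op (z j) := rfl
      have hug : u ∘ₗ g = 0 := by
        refine LinearMap.pi_ext' fun i => LinearMap.ext_ring ?_
        change u (g (Pi.single i 1)) = 0
        rw [hu]
        refine unop_injective ?_
        rw [Finset.unop_sum]
        simpa using hz i
      obtain ⟨a, ha⟩ := exists_comp_eq_of_ker_le hf u (by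
        intro y hy
        obtain ⟨w, rfl⟩ := (hfg y).1 hy
        exact LinearMap.congr_fun hug w)
      refine ⟨ModuleCat.of _ Sᵐᵒᵖ, a, LinearMap.toSpanSingleton Sᵐᵒᵖ K x,
        inferInstanceAs (Module.Projective Sᵐᵒᵖ Sᵐᵒᵖ), fun j => ?_⟩
      have : a (k j) = op (z j) := by
        refine (LinearMap.congr_fun ha (Pi.single j 1)).trans ?_
        rw [hu, Finset.sum_eq_single j] <;> simp +contextual
      rw [this, LinearMap.toSpanSingleton_apply]
    | zero =>
      exact ⟨ModuleCat.of _ Sᵐᵒᵖ, 0, 0, inferInstanceAs (Module.Projective Sᵐᵒᵖ Sᵐᵒᵖ),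
        fun j => rfl⟩
    | add h h' _ _ hh hh' =>
      obtain ⟨Q, a, b, _, hab⟩ := hh
      obtain ⟨Q', a', b', _, hab'⟩ := hh'
      refine ⟨ModuleCat.of _ (Q × Q'), a.prod a', b.coprod b',
        inferInstanceAs (Module.Projective Sᵐᵒᵖ (Q × Q')), fun j => ?_⟩
      rw [Pi.add_apply, ← hab, ← hab']
      rfl
    | neg h _ hh =>
      obtain ⟨Q, a, b, hQ, hab⟩ := hh
      exact ⟨Q, a, -b, hQ, fun j => by rw [LinearMap.neg_apply, hab, Pi.neg_apply]⟩
  obtain ⟨Q, a, b, _, hab⟩ := key k (mem_closure_relations_of_injective_dual hK k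
    (fun i => g (Pi.single i 1)) fun i => by rw [← hk, hfg.apply_apply_eq_zero])
  refine Module.Projective.of_split a b (LinearMap.ext fun x => ?_)
  obtain ⟨y, rfl⟩ := hf x
  rw [hk]
  simp [hab]

theorem IsFPInfty.finitePresentation {A M : Type u} [Ring A] [AddCommGroup M] [Module A M]
    (h : IsFPInfty A M) : Module.FinitePresentation A M := by
  obtain ⟨P, f, _, _, hf, hk⟩ := h.exists_cover
  have := Module.finitePresentation_of_projective A P
  exact Module.finitePresentation_of_surjective f hf (Module.Finite.iff_fg.1 hk.finite)

theorem IsFPInfty.hasProjectiveDimensionLT (hK : IsFPInfty Sᵐᵒᵖ K) {n : ℕ}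
    (hn : HasInjectiveDimensionLT (ModuleCat.of S (Dual S K)) (n + 1)) :
    HasProjectiveDimensionLT (ModuleCat.of Sᵐᵒᵖ K) (n + 1) := by
  induction n generalizing K with
  | zero =>
    have := hK.finitePresentation
    have : Injective (ModuleCat.of S (Dual S K)) := injective_iff_hasInjectiveDimensionLT_one.2 hn
    exact projective_iff_hasProjectiveDimensionLT_one.1 ((IsProjective.iff_projective K).1
      (projective_of_injective_dual (Module.injective_module_of_injective_object S (Dual S K))))
  | succ n ih =>
    obtain ⟨P, f, _, _, hf, hk⟩ := hK.exists_cover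
    have h := isSES_ker hf
    have := (isEquationallyFlat_of_projective (S := S) (F := P)).injective_dual
    refine (h.hasProjectiveDimensionLT_left n).2 (ih hk ?_)
    exact ((h.dual S).shortExact.hasInjectiveDimensionLT_X₃_iff n
      (Module.injective_object_of_injective_module S (Dual S P))).2 hn

end FlatDimension

/-! ### Approximating modules of finite Bass injective dimension, and the converse -/

section Approximation

variable {R : Type u} [Ring R]

/-- `M` has a coresolution of length `n` by direct sums of copies of `ω`. -/
inductive HasAddCoresolution (R ω : Type u) [Ring R] [AddCommGroup ω] [Module R ω] :
    ModuleCat.{u} R → ℕ → Prop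
  | base (I : Type u) : HasAddCoresolution R ω (ModuleCat.of R (I →₀ ω)) 0
  | step {M L : ModuleCat.{u} R} {I : Type u} {n : ℕ} {f : M →ₗ[R] (I →₀ ω)}
      {g : (I →₀ ω) →ₗ[R] L} (h : IsSES f g) (hL : HasAddCoresolution R ω L n) :
      HasAddCoresolution R ω M (n + 1)

/-- For surjections `W → E → H`, the kernel of the composite maps onto the kernel `M` of `E → H`,
with kernel `ker (W → E)`. -/
theorem isSES_ker_comp {W E H M : Type u} [AddCommGroup W] [Module R W] [AddCommGroup E]
    [Module R E] [AddCommGroup H] [Module R H] [AddCommGroup M] [Module R M] {p : W →ₗ[R] E}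
    (hp : Function.Surjective p) {i : M →ₗ[R] E} {q : E →ₗ[R] H} (h : IsSES i q) :
    ∃ (a : LinearMap.ker p →ₗ[R] LinearMap.ker (q ∘ₗ p)) (b : LinearMap.ker (q ∘ₗ p) →ₗ[R] M),
      IsSES a b := by
  let e := LinearEquiv.ofInjective i h.inj
  have hr (w : LinearMap.ker (q ∘ₗ p)) : p w ∈ LinearMap.range i := (h.exact _).1 w.2
  let p' : LinearMap.ker (q ∘ₗ p) →ₗ[R] LinearMap.range i :=
    (p ∘ₗ (LinearMap.ker (q ∘ₗ p)).subtype).codRestrict _ hr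
  refine ⟨Submodule.inclusion (LinearMap.ker_le_ker_comp p q), e.symm.toLinearMap ∘ₗ p',
    Submodule.inclusion_injective _, fun w => ?_, fun m => ?_⟩
  · have : e.symm (p' w) = 0 ↔ p w = 0 := by
      rw [e.symm.map_eq_zero_iff]
      exact Subtype.ext_iff
    exact this.trans ⟨fun hw => ⟨⟨w, hw⟩, rfl⟩, fun ⟨v, hv⟩ => hv ▸ v.2⟩
  · obtain ⟨w, hw⟩ := hp (i m)
    refine ⟨⟨w, ?_⟩, ?_⟩
    · rw [LinearMap.mem_ker, LinearMap.comp_apply, hw, h.exact.apply_apply_eq_zero]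
    · refine e.symm_apply_eq.2 (Subtype.ext ?_)
      exact hw

variable {S ω : Type u} [Ring S] [AddCommGroup ω] [Module R ω] [Module Sᵐᵒᵖ ω]
  [SMulCommClass R Sᵐᵒᵖ ω]

/-- For `0 → M → C → L → 0` and an approximation `0 → X → H → L → 0`, the pullback `E = C ×_L H` is
an extension of `C` by `X`, hence Bass. Let `ω^(I) → E` be a cover with Bass kernel. The kernel of
`ω^(I) → E → H` maps onto `M` with that same Bass kernel, and its coresolution is one step longer
than that of `H`. -/
theorem HasCoresolution.exists_approximation (hω : IsSemidualizing R S ω) {n : ℕ}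
    {M : ModuleCat.{u} R} (h : HasCoresolution (bassClass R S ω) M n) :
    ∃ (X H : ModuleCat.{u} R) (a : X →ₗ[R] H) (b : H →ₗ[R] M), bassClass R S ω X ∧
      HasAddCoresolution R ω H n ∧ IsSES a b := by
  induction n generalizing M with
  | zero =>
    obtain ⟨C, hC, ⟨e⟩⟩ := h.of_zero
    obtain ⟨-, I, g, hg, hk⟩ := hasCovers_bassClass hω C hC
    refine ⟨_, _, _, e.symm.toLinearMap ∘ₗ g, hk, .base I, (isSES_ker hg).inj, ?_,
      e.symm.surjective.comp hg⟩
    intro x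
    exact (e.symm.map_eq_zero_iff (x := g x)).trans ((isSES_ker hg).exact x)
  | succ n ih =>
    obtain ⟨C, L, f, g, hC, hfg, hL⟩ := h.of_succ
    obtain ⟨X, H, a, b, hX, hH, hab⟩ := ih hL
    let E : Submodule R (C × H) := LinearMap.ker (g ∘ₗ LinearMap.fst R C H -
      b ∘ₗ LinearMap.snd R C H)
    have hE (x : C × H) : x ∈ E ↔ g x.1 = b x.2 := by
      rw [LinearMap.mem_ker, LinearMap.sub_apply, sub_eq_zero]; rfl
    let i : M →ₗ[R] E := (LinearMap.inl R C H ∘ₗ f).codRestrict E fun m => by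
      rw [hE]; exact (hfg.exact.apply_apply_eq_zero m).trans (map_zero b).symm
    let j : X →ₗ[R] E := (LinearMap.inr R C H ∘ₗ a).codRestrict E fun x => by
      rw [hE]; exact (map_zero g).trans (hab.exact.apply_apply_eq_zero x).symm
    have hi : IsSES i (LinearMap.snd R C H ∘ₗ E.subtype) := by
      refine ⟨fun m m' hm => hfg.inj (congrArg (fun x : E => x.1.1) hm), fun x => ?_, fun y => ?_⟩
      · constructor
        · intro hx
          have hx' : x.1.2 = 0 := hx
          obtain ⟨m, hm⟩ := (hfg.exact x.1.1).1 (by rw [(hE x.1).1 x.2, hx', map_zero])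
          exact ⟨m, Subtype.ext (Prod.ext hm hx'.symm)⟩
        · rintro ⟨m, rfl⟩
          rfl
      · obtain ⟨c, hc⟩ := hfg.surj (b y)
        exact ⟨⟨(c, y), (hE _).2 hc⟩, rfl⟩
    have hj : IsSES j (LinearMap.fst R C H ∘ₗ E.subtype) := by
      refine ⟨fun m m' hm => hab.inj (congrArg (fun x : E => x.1.2) hm), fun x => ?_, fun y => ?_⟩
      · constructor
        · intro hx
          have hx' : x.1.1 = 0 := hx
          obtain ⟨m, hm⟩ := (hab.exact x.1.2).1 (by rw [← (hE x.1).1 x.2, hx', map_zero])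
          exact ⟨m, Subtype.ext (Prod.ext hx'.symm hm)⟩
        · rintro ⟨m, rfl⟩
          rfl
      · obtain ⟨c, hc⟩ := hab.surj (g y)
        exact ⟨⟨(y, c), (hE _).2 hc.symm⟩, rfl⟩
    have hEB : bassClass R S ω (ModuleCat.of R E) :=
      IsSES.bassClass_middle (E := ModuleCat.of R E) hω hj hX hC
    obtain ⟨-, I, p, hp, hk⟩ := hasCovers_bassClass hω _ hEB
    obtain ⟨a', b', hab'⟩ := isSES_ker_comp (E := E) hp hi
    exact ⟨_, ModuleCat.of R _, a', b', hk,
      .step (isSES_ker (hi.surj.comp hp)) hH, hab'⟩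

/-- The character module of the right `S`-module `Hom_R(M, ω)`. -/
abbrev HomDual (S ω : Type u) [Ring S] [AddCommGroup ω] [Module R ω] [Module Sᵐᵒᵖ ω]
    [SMulCommClass R Sᵐᵒᵖ ω] (M : ModuleCat.{u} R) : ModuleCat.{u} S :=
  ModuleCat.of S (Dual S (M →ₗ[R] ω))

/-- Vanishing of `Ext(-, ω)` is carried along because it keeps each step exact under `Hom_R(-, ω)`.
Passing to characters then gives a coresolution by the injective modules `Hom_R(ω^(I), ω)⁺`. -/
theorem HasAddCoresolution.extVanish_and_injectiveDimension (hω : IsSemidualizing R S ω)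
    (hS : IsLeftCoherent S) {n : ℕ} {M : ModuleCat.{u} R} (h : HasAddCoresolution R ω M n) :
    ExtVanish R M ω ∧ HasInjectiveDimensionLT (HomDual S ω M) (n + 1) := by
  have hinj (I : Type u) : Injective (HomDual S ω (ModuleCat.of R (I →₀ ω))) := by
    have := (hS.isEquationallyFlat_hom_finsupp hω.homothety_right I).injective_dual
    exact Module.injective_object_of_injective_module S (Dual S ((I →₀ ω) →ₗ[R] ω))
  induction h with
  | base I =>
    exact ⟨ExtVanish.finsupp_left hω.ext_left I,
      injective_iff_hasInjectiveDimensionLT_one.1 (hinj I)⟩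
  | @step M L I n f g h hL ih =>
    refine ⟨h.extVanish_contra_left (ExtVanish.finsupp_left hω.ext_left I) ih.1, ?_⟩
    have hd := (h.precomp Sᵐᵒᵖ ω (h.extend_of_ext (ih.1 1 le_rfl))).dual S
    exact (hd.shortExact.hasInjectiveDimensionLT_X₃_iff n (hinj I)).1 ih.2

theorem pdRight_le_of_relInjDim_le (hω : IsSemidualizing R S ω) (hS : IsLeftCoherent S) {n : ℕ}
    (h : relInjDim (bassClass R S ω) (ModuleCat.of R R) ≤ n) : pdRight S ω ≤ n := by
  obtain ⟨m, hm, h⟩ := relInjDim_le_iff.1 h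
  obtain ⟨X, H, a, b, -, hH, hab⟩ := h.exists_approximation hω
  obtain ⟨-, hdim⟩ := hH.extVanish_and_injectiveDimension hω hS
  obtain ⟨h₀, hh₀⟩ := hab.surj 1
  -- `ω` is a retract of `Hom_R(H, ω)`, as `H → R` splits
  let i : ω →ₗ[Sᵐᵒᵖ] (H →ₗ[R] ω) :=
    { toFun := fun x => LinearMap.toSpanSingleton R ω x ∘ₗ b
      map_add' := fun x y => LinearMap.ext fun z => smul_add (b z) x y
      map_smul' := fun s x => LinearMap.ext fun z => smul_comm (b z) s x }
  let r : (H →ₗ[R] ω) →ₗ[Sᵐᵒᵖ] ω :=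
    { toFun := fun u => u h₀
      map_add' := fun _ _ => rfl
      map_smul' := fun _ _ => rfl }
  have hri (x : ω) : r (i x) = x := by
    change b h₀ • x = x
    rw [hh₀]
    exact one_smul R x
  have ret : Retract (ModuleCat.of S (Dual S ω)) (HomDual S ω H) :=
    { i := ModuleCat.ofHom (Dual.map S r)
      r := ModuleCat.ofHom (Dual.map S i)
      retract := ModuleCat.hom_ext (LinearMap.ext fun χ => Dual.ext S fun x =>
        congrArg χ (hri x)) }
  have := hω.isFPInfty_right.hasProjectiveDimensionLT (ret.hasInjectiveDimensionLT (m + 1))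
  exact ((projectiveDimension_le_iff _ m).2 this).trans (by exact_mod_cast hm)

end Approximation

end SemidualizingBimodule

end

theorem theorem4p8 (R S ω : Type u) [Ring R] [Ring S] [AddCommGroup ω] [Module R ω]
    [Module Sᵐᵒᵖ ω] [SMulCommClass R Sᵐᵒᵖ ω]
    (hω : SemidualizingBimodule.IsSemidualizing R S ω) :
    (SemidualizingBimodule.IsRightSemiTilting R S ω →
      SemidualizingBimodule.bassClass R S ω = SemidualizingBimodule.extPerp R ω) ∧
    (SemidualizingBimodule.IsLeftCoherent S → ∀ n : ℕ,
      (SemidualizingBimodule.IsRightSemiTilting R S ω ∧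
          SemidualizingBimodule.pdRight S ω ≤ (n : WithBot ℕ∞)) ↔
        SemidualizingBimodule.relInjDim (SemidualizingBimodule.bassClass R S ω)
          (ModuleCat.of R R) ≤ (n : ℕ∞)) := by
  -- This order of the commuting actions provides the `R`-module structure on `Hom_{S^op}(-, ω)`.
  have : SMulCommClass Sᵐᵒᵖ R ω := SMulCommClass.symm R Sᵐᵒᵖ ω
  refine ⟨fun h => h.bassClass_eq, fun hS n => ⟨fun h => h.1.relInjDim_le h.2, fun h => ?_⟩⟩
  have hn := SemidualizingBimodule.pdRight_le_of_relInjDim_le hω hS h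
  exact ⟨⟨hω, lt_top_iff_ne_top.2
    ((projectiveDimension_ne_top_iff _).2 ⟨n, (projectiveDimension_le_iff _ n).1 hn⟩)⟩, hn⟩
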